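/- **Setting.** Let $\mathcal X$ be a measurable space of contexts, $\mathcal A$ a finite non-empty set of $K$ arms, and $D$ a probability distribution of pairs $(x,r)$ with $x\in\mathcal X$, $r\in[0,1]^{\mathcal A}$; write $D_{\mathcal X}$ for the law of $x$ and $f^*(x,a)=\mathbb E[r(a)\mid x]$, a measurable function with values in $[0,1]$. A model is a measurable map $\mathcal X\times\mathcal A\to[0,1]$. For a probability kernel $p$ from $\mathcal X$ to $\mathcal A$, $D(p)$ is the law of $(x,a,r(a))$, where $(x,r)\sim D$ and then $a\sim p(\cdot\mid x)$. Let $\mathcal F_1,\dots,\mathcal F_M$ ($M\ge1$) be non-empty classes of models with finite VC subgraph dimensions $1\le d_1\le\dots\le d_M$. Put $$b_i(p)=\inf_{f\in\mathcal F_i}\mathbb E_{x\sim D_{\mathcal X}}\mathbb E_{a\sim p(\cdot\mid x)}\big[(f(x,a)-f^*(x,a))^2\big],\qquad B_i=\sup_p b_i(p),\qquad \xi_i(n,\zeta)=\frac{C_1d_i\ln(n)\ln(1/\zeta)}{n},$$ where $C_1>0$. Let $\delta\in(0,1)$, let $\tau_1\ge2$ be an integer, $\tau_0=0$, and $\tau_{m+1}=2\tau_m$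 for $m\ge1$. **Algorithm (Mod-IGW).** Epoch $m\ge1$ consists of the rounds $\tau_{m-1}<t\le\tau_m$. Start with $\hat f_1\equiv0$, $\mathcal I_1=\{1,\dots,M\}$, $\gamma_1=1$. In every round $t$ a pair $(x_t,r_t)\sim D$ is drawn independently of the past, the learner sees $x_t$, draws $a_t\sim p_m(\cdot\mid x_t)$ where $m$ is the current epoch, and sees $r_t(a_t)$. Here, with $\hat a\in\arg\max_a\hat f_m(x,a)$ (ties broken by a fixed measurable rule), $$p_m(a\mid x)=\frac1{K+\gamma_m(\hat f_m(x,\hat a)-\hat f_m(x,a))}\ \ (a\ne\hat a),\qquad p_m(\hat a\mid x)=1-\sum_{a'\ne\hat a}p_m(a'\mid x).$$ With $S_m$ the observations $(x_t,a_t,r_t(a_t))$ of epoch $m$, put at its end $\hat f_{m+1}=\mathrm{EstOracle}_M(S_m)$, $\mathcal I_{m+1}=\{i\in\mathcal I_m:\mathrm{MTOracle}(i,S_m,\delta/(4Mm^2))=\mathbf{False}\}$, $i_{m+1}=\min\mathcal I_{m+1}$ (and $i_{m+1}=M$ if $\mathcal I_{m+1}=\emptyset$), and $\gamma_{m+1}=\sqrt{K/\big(8\,\xi_{i_{m+1}}(\tau_m-\tau_{m-1},\delta/(4Mm^2))\big)}$.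 The oracles are measurable functions of their data. **Assumptions.** 1. (Realizability) $B_i=0$ for some $i$; let $i^*$ be the smallest such index. 2. (Estimation oracle) There is a constant $C_0\ge1$ such that for all $i\le M$, all probability kernels $p$, all $n\ge2$ and all $\zeta\in(0,1)$, the output $\hat f$ of $\mathrm{EstOracle}_i$ on $n$ i.i.d. samples from $D(p)$ satisfies, with probability at least $1-\zeta$, $$\mathbb E_{x\sim D_{\mathcal X}}\mathbb E_{a\sim p(\cdot\mid x)}\big[(\hat f(x,a)-f^*(x,a))^2\big]\le\min_{j\le i}\big(C_0b_j(p)+\xi_j(n,\zeta/i)\big).$$ 3. (Misspecification test) Let $m_i^*=\sup\{m\ge1:\xi_i(\tau_m-\tau_{m-1},\delta/(4Mm^2))\ge C_0\min_{i'\le i}B_{i'}\}$ (possibly $\infty$, and $0$ if the set is empty; $\tau_\infty=\infty$). There are $\beta_i'\in(0,1]$ and $\beta_i\in(0,\infty]$, with $\beta_i$ non-decreasing in $i$, $\beta_i'\tau_{m_i^*}<\beta_i<\infty$ whenever $\tau_{m_i^*}<\infty$, and $\beta_i=\infty$ otherwise, such that for all $i\le M$, $m\ge1$ and $\zeta\in(0,1)$: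 if $\tau_m\le\beta_i'\tau_{m_i^*}$ then $\Pr[\mathrm{MTOracle}(i,S_m,\zeta)=\mathbf{False}]\ge1-\zeta$, and if $\tau_m>\beta_i$ then $\Pr[\mathrm{MTOracle}(i,S_m,\zeta)=\mathbf{True}]\ge1-\zeta$. **Claim.** Let $\pi^*(x)\in\arg\max_af^*(x,a)$ and $R_t=\sum_{s=1}^t\big[f^*(x_s,\pi^*(x_s))-f^*(x_s,a_s)\big]$. There is a constant $C$ that depends only on $C_1$ and $\tau_1$ such that, under these assumptions, with probability at least $1-\delta$, for all rounds $t\ge3$ simultaneously, $$R_t\le C\,d_{i^*}\sqrt{K\,t\,\ln(t)\,\ln\!\Big(\frac{M\ln t}{\delta}\Big)}.$$ -/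

import Mathlib

open MeasureTheory ProbabilityTheory
open scoped ENNReal

noncomputable section

namespace ContextualBandit

/-- A model: a (measurable) map from contexts and arms to `[0,1]`. -/
structure Model (𝒳 𝒜 : Type*) [MeasurableSpace 𝒳] where
  toFun : 𝒳 → 𝒜 → unitInterval
  measurable_toFun : ∀ a, Measurable fun x => toFun x a

instance {𝒳 𝒜 : Type*} [MeasurableSpace 𝒳] : CoeFun (Model 𝒳 𝒜) (fun _ => 𝒳 → 𝒜 → ℝ) :=
  ⟨fun f x a => (f.toFun x a : ℝ)⟩

/-- The model that is identically `0`. -/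
def zeroModel (𝒳 𝒜 : Type*) [MeasurableSpace 𝒳] : Model 𝒳 𝒜 :=
  ⟨fun _ _ => 0, fun _ => measurable_const⟩

/-- What the learner observes in one round: context, chosen arm, reward of the chosen arm. -/
abbrev Obs (𝒳 𝒜 : Type*) := 𝒳 × 𝒜 × unitInterval

/-! ### VC subgraph dimension -/

/-- `F` shatters the finite set `s` of points of `(𝒳 × 𝒜) × ℝ`: every subset of `s` is cut out of
`s` by the subgraph `{((x, a), y) | y < f x a}` of some `f ∈ F`. -/
def SubgraphShatters {𝒳 𝒜 : Type*} [MeasurableSpace 𝒳] (F : Set (Model 𝒳 𝒜))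
    (s : Finset ((𝒳 × 𝒜) × ℝ)) : Prop :=
  ∀ u ⊆ s, ∃ f ∈ F, ∀ q ∈ s, q.2 < f q.1.1 q.1.2 ↔ q ∈ u

/-- The VC subgraph dimension: the largest size of a finite set shattered by the subgraphs. -/
def vcSubgraphDim {𝒳 𝒜 : Type*} [MeasurableSpace 𝒳] (F : Set (Model 𝒳 𝒜)) : ℕ∞ :=
  ⨆ (s : Finset ((𝒳 × 𝒜) × ℝ)) (_ : SubgraphShatters F s), (s.card : ℕ∞)

/-! ### The environment -/

section Environment

variable {𝒳 𝒜 : Type*} [MeasurableSpace 𝒳] [MeasurableSpace 𝒜]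

/-- `f⋆ x a = 𝔼[r a | x]` for `(x, r) ∼ D`. -/
def IsMeanReward (D : Measure (𝒳 × (𝒜 → unitInterval))) (fstar : Model 𝒳 𝒜) : Prop :=
  ∀ a : 𝒜, D[fun q => (q.2 a : ℝ) | MeasurableSpace.comap Prod.fst inferInstance]
    =ᵐ[D] fun q => fstar q.1 a

/-- The distribution `D(p)` of `(x, a, r a)`, where `(x, r) ∼ D` and then `a ∼ p(· | x)`. -/
def obsLaw (D : Measure (𝒳 × (𝒜 → unitInterval))) (p : Kernel 𝒳 𝒜) : Measure (Obs 𝒳 𝒜) :=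
  (D ⊗ₘ p.comap Prod.fst measurable_fst).map fun q => (q.1.1, q.2, q.1.2 q.2)

/-- `𝔼_{x ∼ D_𝒳} 𝔼_{a ∼ p(· | x)} (f x a - g x a)²`. -/
def sqDist (D : Measure (𝒳 × (𝒜 → unitInterval))) (p : Kernel 𝒳 𝒜) (f g : Model 𝒳 𝒜) : ℝ :=
  ∫ x, ∫ a, (f x a - g x a) ^ 2 ∂(p x) ∂D.fst

/-- The average squared misspecification error `b(p)` of the class `F` under `D(p)`. -/
def misspec (D : Measure (𝒳 × (𝒜 → unitInterval))) (fstar : Model 𝒳 𝒜) (F : Set (Model 𝒳 𝒜))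
    (p : Kernel 𝒳 𝒜) : ℝ :=
  ⨅ f : F, sqDist D p f fstar

/-- The average squared misspecification error `B` of the class `F`: the worst case of `b(p)` over
all probability kernels `p`. -/
def maxMisspec (D : Measure (𝒳 × (𝒜 → unitInterval))) (fstar : Model 𝒳 𝒜)
    (F : Set (Model 𝒳 𝒜)) : ℝ :=
  ⨆ p : {p : Kernel 𝒳 𝒜 // IsMarkovKernel p}, misspec D fstar F p

/-- Cumulative regret up to round `t` of the arms `a` on the contexts `x`. -/
def regret (fstar : Model 𝒳 𝒜) (πstar : 𝒳 → 𝒜) (x : ℕ → 𝒳) (a : ℕ → 𝒜) (t : ℕ) : ℝ :=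
  ∑ s ∈ Finset.Icc 1 t, (fstar (x s) (πstar (x s)) - fstar (x s) (a s))

end Environment

/-! ### Oracles -/

/-- A regression oracle: it maps every finite sample to a model, measurably. -/
structure RegressionOracle (𝒳 𝒜 : Type*) [MeasurableSpace 𝒳] [MeasurableSpace 𝒜] where
  fit : (n : ℕ) → (Fin n → Obs 𝒳 𝒜) → Model 𝒳 𝒜
  measurable_fit : ∀ n a, Measurable fun q : (Fin n → Obs 𝒳 𝒜) × 𝒳 => (fit n q.1).toFun q.2 a

/-- A misspecification test: `test i n S ζ` is the output on the class index `i`, a sample `S` of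
size `n` and the confidence parameter `ζ`; the output `true` claims misspecification. -/
structure TestOracle (𝒳 𝒜 : Type*) [MeasurableSpace 𝒳] [MeasurableSpace 𝒜] (M : ℕ) where
  test : Fin M → (n : ℕ) → (Fin n → Obs 𝒳 𝒜) → ℝ → Bool
  measurable_test : ∀ i n ζ, Measurable fun S => test i n S ζ

/-- A measurable rule that selects a maximizing arm. -/
structure ArgmaxRule (𝒜 : Type*) [MeasurableSpace 𝒜] where
  pick : (𝒜 → ℝ) → 𝒜
  le_pick : ∀ (v : 𝒜 → ℝ) (a : 𝒜), v a ≤ v (pick v)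
  measurable_pick : Measurable pick

/-- The estimation rate `ξ(n, ζ) = C₁ d ln(n) ln(1/ζ) / n`. -/
def rate (C₁ : ℝ) (d n : ℕ) (ζ : ℝ) : ℝ :=
  C₁ * d * Real.log n * Real.log (1 / ζ) / n

/-- The last round `τ_m` of epoch `m`: `τ₀ = 0` and `τ_{m+1} = 2 τ_m` for `m ≥ 1`. -/
def epochEnd (τ₁ : ℕ) : ℕ → ℕ
  | 0 => 0
  | m + 1 => 2 ^ m * τ₁

/-- The number of rounds of epoch `m ≥ 1`. -/
def epochLength (τ₁ m : ℕ) : ℕ := epochEnd τ₁ m - epochEnd τ₁ (m - 1)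

/-- `τ_m` for possibly infinite `m`, with `τ_∞ = ∞`. -/
def epochEndExt (τ₁ : ℕ) (m : ℕ∞) : ℝ≥0∞ :=
  ⨆ (k : ℕ) (_ : (k : ℕ∞) ≤ m), (epochEnd τ₁ k : ℝ≥0∞)

/-! ### The algorithm -/

/-- Everything that the algorithm is given. Class indices `1, …, M` are the elements of `Fin M`,
in order. -/
structure ModIGW (𝒳 𝒜 : Type*) [MeasurableSpace 𝒳] [MeasurableSpace 𝒜] (M : ℕ) where
  /-- initial epoch length -/
  τ₁ : ℕ
  /-- confidence parameter -/
  δ : ℝ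
  /-- constant of the estimation rates -/
  C₁ : ℝ
  /-- complexities of the classes, which enter the estimation rates -/
  d : Fin M → ℕ
  /-- estimation oracles -/
  est : Fin M → RegressionOracle 𝒳 𝒜
  /-- misspecification test -/
  mt : TestOracle 𝒳 𝒜 M
  /-- selection of the predicted best arm -/
  best : ArgmaxRule 𝒜

namespace ModIGW

variable {𝒳 𝒜 : Type*} [MeasurableSpace 𝒳] [MeasurableSpace 𝒜] {M : ℕ} (alg : ModIGW 𝒳 𝒜 M)

/-- The estimation rate `ξ_i(n, ζ)`. -/
def ξ (i : Fin M) (n : ℕ) (ζ : ℝ) : ℝ := rate alg.C₁ (alg.d i) n ζ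

/-- The confidence level `δ / (4 M m²)` used at the end of epoch `m`. -/
def conf (m : ℕ) : ℝ := alg.δ / (4 * M * (m : ℝ) ^ 2)

/-- The sample `S_m` collected in epoch `m ≥ 1`, out of the observations `z 1, z 2, …`. -/
def sample (z : ℕ → Obs 𝒳 𝒜) (m : ℕ) : Fin (epochLength alg.τ₁ m) → Obs 𝒳 𝒜 :=
  fun k => z (epochEnd alg.τ₁ (m - 1) + 1 + k)

/-- The index set `𝓘_m` for epoch `m ≥ 1` (the value at `0` is not used). -/
def indexSet (z : ℕ → Obs 𝒳 𝒜) : ℕ → Finset (Fin M)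
  | 0 => Finset.univ
  | 1 => Finset.univ
  | m + 2 => (indexSet z (m + 1)).filter fun i =>
      alg.mt.test i _ (alg.sample z (m + 1)) (alg.conf (m + 1)) = false

/-- The exploration parameter `γ_{m+1,i}`, for `m ≥ 1`. -/
def gammaClass [Fintype 𝒜] (m : ℕ) (i : Fin M) : ℝ :=
  Real.sqrt (Fintype.card 𝒜 / (8 * alg.ξ i (epochLength alg.τ₁ m) (alg.conf m)))

section Nonzero

variable [NeZero M]

/-- The smallest element `i_m` of the index set (the largest class index if the set is empty). -/
def index (z : ℕ → Obs 𝒳 𝒜) (m : ℕ) : Fin M :=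
  if h : (alg.indexSet z m).Nonempty then (alg.indexSet z m).min' h else ⊤

/-- The exploration parameter `γ_m` for epoch `m ≥ 1` (the value at `0` is not used). -/
def gamma [Fintype 𝒜] (z : ℕ → Obs 𝒳 𝒜) : ℕ → ℝ
  | 0 => 1
  | 1 => 1
  | m + 2 => alg.gammaClass (m + 1) (alg.index z (m + 2))

/-- The estimated model for epoch `m ≥ 1` (the value at `0` is not used). -/
def fitted (z : ℕ → Obs 𝒳 𝒜) : ℕ → Model 𝒳 𝒜
  | 0 => zeroModel 𝒳 𝒜
  | 1 => zeroModel 𝒳 𝒜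
  | m + 2 => (alg.est ⊤).fit _ (alg.sample z (m + 1))

/-- The predicted best arm at context `x` in epoch `m`. -/
def bestArm (z : ℕ → Obs 𝒳 𝒜) (m : ℕ) (x : 𝒳) : 𝒜 := alg.best.pick (alg.fitted z m x)

/-- The probability of an arm other than the predicted best one. -/
def igw [Fintype 𝒜] (z : ℕ → Obs 𝒳 𝒜) (m : ℕ) (x : 𝒳) (a : 𝒜) : ℝ :=
  1 / (Fintype.card 𝒜 +
    alg.gamma z m * (alg.fitted z m x (alg.bestArm z m x) - alg.fitted z m x a))

/-- The action selection kernel `p_m(a | x)` of epoch `m`. It depends on the observations `z` only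
through the epochs before `m`. -/
def actionProb [Fintype 𝒜] [DecidableEq 𝒜] (z : ℕ → Obs 𝒳 𝒜) (m : ℕ) (x : 𝒳) (a : 𝒜) : ℝ :=
  if a = alg.bestArm z m x then
    1 - ∑ a' ∈ Finset.univ.erase (alg.bestArm z m x), alg.igw z m x a'
  else alg.igw z m x a

end Nonzero

end ModIGW

/-! ### Runs of the algorithm -/

section Run

variable {𝒳 𝒜 Ω : Type*} [MeasurableSpace 𝒳] [MeasurableSpace 𝒜]

/-- The observations made along contexts `x`, reward vectors `r` and arms `a`. -/
def observations (x : ℕ → Ω → 𝒳) (r : ℕ → Ω → 𝒜 → unitInterval) (a : ℕ → Ω → 𝒜) (ω : Ω) :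
    ℕ → Obs 𝒳 𝒜 :=
  fun s => (x s ω, a s ω, r s ω (a s ω))

/-- The σ-algebra generated by the rounds `1, …, t - 1`. -/
@[reducible] def past (x : ℕ → Ω → 𝒳) (r : ℕ → Ω → 𝒜 → unitInterval) (a : ℕ → Ω → 𝒜) (t : ℕ) :
    MeasurableSpace Ω :=
  ⨆ s ∈ Set.Ico 1 t, MeasurableSpace.comap (fun ω => (x s ω, r s ω, a s ω)) inferInstance

/-- The σ-algebra generated by the context and the reward vector of round `t`. -/
@[reducible] def draw (x : ℕ → Ω → 𝒳) (r : ℕ → Ω → 𝒜 → unitInterval) (t : ℕ) : MeasurableSpace Ω :=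
  MeasurableSpace.comap (fun ω => (x t ω, r t ω)) inferInstance

/-- The contexts `x t`, reward vectors `r t` and arms `a t` (rounds `t ≥ 1`) are those of a run of
the algorithm in the environment `D`: in every round `(x t, r t)` is drawn from `D` independently
of the past, and then, in epoch `m`, the arm `a t` is drawn from `p_m(· | x t)`. -/
structure IsRun [MeasurableSpace Ω] [Fintype 𝒜] [DecidableEq 𝒜] {M : ℕ} [NeZero M]
    (alg : ModIGW 𝒳 𝒜 M) (D : Measure (𝒳 × (𝒜 → unitInterval))) (P : Measure Ω)
    (x : ℕ → Ω → 𝒳) (r : ℕ → Ω → 𝒜 → unitInterval) (a : ℕ → Ω → 𝒜) : Prop where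
  measurable_context : ∀ t, Measurable (x t)
  measurable_reward : ∀ t, Measurable (r t)
  measurable_arm : ∀ t, Measurable (a t)
  law_draw : ∀ t, 1 ≤ t → P.map (fun ω => (x t ω, r t ω)) = D
  indep_draw : ∀ t, 1 ≤ t → Indep (draw x r t) (past x r a t) P
  law_arm : ∀ m, 1 ≤ m → ∀ t, epochEnd alg.τ₁ (m - 1) < t → t ≤ epochEnd alg.τ₁ m → ∀ b : 𝒜,
    P[(a t ⁻¹' {b}).indicator (fun _ => (1 : ℝ)) | past x r a t ⊔ draw x r t]
      =ᵐ[P] fun ω => alg.actionProb (observations x r a ω) m (x t ω) b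

end Run

/-! ### Assumptions on the oracles -/

section Assumptions

variable {𝒳 𝒜 : Type*} [MeasurableSpace 𝒳] [MeasurableSpace 𝒜] {M : ℕ}

/-- The guarantee of the estimation oracles, with constant `C₀`. The rate vanishes at `n = 1`, so
only samples of size at least two are considered. -/
def EstimationGuarantee (alg : ModIGW 𝒳 𝒜 M) (D : Measure (𝒳 × (𝒜 → unitInterval)))
    (fstar : Model 𝒳 𝒜) (F : Fin M → Set (Model 𝒳 𝒜)) (C₀ : ℝ) : Prop :=
  ∀ (i : Fin M) (p : Kernel 𝒳 𝒜), IsMarkovKernel p → ∀ n : ℕ, 2 ≤ n → ∀ ζ : ℝ, 0 < ζ → ζ < 1 →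
    ENNReal.ofReal (1 - ζ) ≤ Measure.pi (fun _ : Fin n => obsLaw D p)
      {S | sqDist D p ((alg.est i).fit n S) fstar ≤
        ⨅ j : Set.Iic i, (C₀ * misspec D fstar (F j) p + alg.ξ j n (ζ / ((i : ℕ) + 1)))}

/-- The safe epoch `m⋆_i`: the largest `m ≥ 1` with `ξ_i(τ_m - τ_{m-1}, δ/(4Mm²)) ≥ C₀ min_{i' ≤ i}
B_{i'}`, which is `∞` if there are arbitrarily large such `m`, and `0` if there is none. -/
def safeEpoch (alg : ModIGW 𝒳 𝒜 M) (D : Measure (𝒳 × (𝒜 → unitInterval)))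
    (fstar : Model 𝒳 𝒜) (F : Fin M → Set (Model 𝒳 𝒜)) (C₀ : ℝ) (i : Fin M) : ℕ∞ :=
  ⨆ (m : ℕ) (_ : 1 ≤ m ∧ C₀ * (⨅ i' : Set.Iic i, maxMisspec D fstar (F i')) ≤
    alg.ξ i (epochLength alg.τ₁ m) (alg.conf m)), (m : ℕ∞)

/-- The guarantee of the misspecification test on the samples `S_m` collected along a run. Where
`τ_{m⋆_i} = ∞` the threshold `β i` is `∞`. -/
def TestGuarantee {Ω : Type*} [MeasurableSpace Ω] (alg : ModIGW 𝒳 𝒜 M)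
    (D : Measure (𝒳 × (𝒜 → unitInterval))) (fstar : Model 𝒳 𝒜) (F : Fin M → Set (Model 𝒳 𝒜))
    (C₀ : ℝ) (P : Measure Ω) (z : Ω → ℕ → Obs 𝒳 𝒜) : Prop :=
  ∃ β' β : Fin M → ℝ≥0∞, Monotone β ∧
    (∀ i, 0 < β' i ∧ β' i ≤ 1) ∧
    (∀ i, epochEndExt alg.τ₁ (safeEpoch alg D fstar F C₀ i) = ∞ → β i = ∞) ∧
    (∀ i, epochEndExt alg.τ₁ (safeEpoch alg D fstar F C₀ i) < ∞ →
      β' i * epochEndExt alg.τ₁ (safeEpoch alg D fstar F C₀ i) < β i ∧ β i < ∞) ∧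
    ∀ (i : Fin M) (m : ℕ), 1 ≤ m → ∀ ζ : ℝ, 0 < ζ → ζ < 1 →
      ((epochEnd alg.τ₁ m : ℝ≥0∞) ≤
          β' i * epochEndExt alg.τ₁ (safeEpoch alg D fstar F C₀ i) →
        ENNReal.ofReal (1 - ζ) ≤ P {ω | alg.mt.test i _ (alg.sample (z ω) m) ζ = false}) ∧
      (β i < (epochEnd alg.τ₁ m : ℝ≥0∞) →
        ENNReal.ofReal (1 - ζ) ≤ P {ω | alg.mt.test i _ (alg.sample (z ω) m) ζ = true})

end Assumptions

end ContextualBandit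

end

open ContextualBandit

/-! Two facts about the run, each holding in all epochs with high probability, carry the bound.
Write i* for the smallest realizable index, d* for its dimension, K for the number of arms, u_m for
the estimation rate of epoch m at dimension one, and s_m = √(K u_m).

Accuracy. Given the past, the sample of epoch m is i.i.d. from D(p_m) (`IsRun.lintegral_sample`), so
the guarantee of the estimation oracle, valid for every fixed kernel, applies to the random kernel
p_m. Its minimum over classes includes i*, whose misspecification vanishes under every kernel. Hence
the next model has squared error at most d* u_m under p_m, whichever index the algorithm currently
uses.

Safety. The safe epoch of i* is infinite, so the test is always in the regime where it accepts i*.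
Thus i* stays in the index set, every i_m is at most i*, and by monotonicity its dimension is at
most d*. Hence K/√(8 d*) ≤ γ_{m+1} s_m ≤ K/√8.

On these events the argument is the inverse gap weighting induction. The kernel satisfies p_m(a|x)
(K + γ_m gap) ≥ 1, so an AM-GM inequality with a free parameter θ bounds the error of the new model
under any policy Q by the error under p_m plus the regret of Q for the old model
(`IsPolicy.integral_abs_sub_le`). By induction the old regret is comparable to the true one, and
`policyRegret_le_of_estimate` transfers this to the new model: `policyRegret_comparable` gives
factor 2 and additive error 5 d* s_m in both directions. The upper bound on γ_{m+1} s_m closes the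
induction. The lower bound makes the regret K/γ_{m+1} of p_{m+1} for its own model at most 3 d* s_m,
so its true expected regret is at most 11 d* s_m. The parameter θ is tuned to u_m and not to the
unknown d*, which is why d* enters linearly.

A round s in an epoch after the first has s_m of order √(K log t log(M log t/δ)/s); summing 1/√s
gives the rate. The first epoch costs at most τ₁, and an exponential moment bound controls the
difference between realized and expected regret. A union bound over epochs and rounds finishes the
proof. -/

noncomputable section

set_option linter.unusedSectionVars false

namespace ContextualBandit

/-! ### Epochs -/

section Epochs

lemma epochEnd_succ (τ m : ℕ) : epochEnd τ (m + 1) = 2 ^ m * τ := rfl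

lemma epochEnd_mono (τ : ℕ) : Monotone (epochEnd τ) := by
  refine monotone_nat_of_le_succ fun m => ?_
  cases m with
  | zero => simp [epochEnd]
  | succ m => simp only [epochEnd_succ, pow_succ]; nlinarith [Nat.zero_le (2 ^ m * τ)]

lemma epochLength_one (τ : ℕ) : epochLength τ 1 = τ := by simp [epochLength, epochEnd]

lemma epochLength_add_two (τ m : ℕ) : epochLength τ (m + 2) = 2 ^ m * τ := by
  simp only [epochLength, epochEnd_succ, show m + 2 - 1 = m + 1 from rfl, pow_succ]
  rw [show 2 ^ m * 2 * τ = 2 ^ m * τ + 2 ^ m * τ by ring, Nat.add_sub_cancel]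

lemma le_epochLength {τ m : ℕ} (hm : 1 ≤ m) : τ ≤ epochLength τ m := by
  obtain _ | _ | m := m
  · omega
  · exact (epochLength_one τ).ge
  · rw [epochLength_add_two]; exact Nat.le_mul_of_pos_left _ (by positivity)

lemma epochEnd_pred_add_epochLength (τ m : ℕ) :
    epochEnd τ (m - 1) + epochLength τ m = epochEnd τ m := by
  have := epochEnd_mono τ (Nat.sub_le m 1)
  unfold epochLength; omega

lemma lt_epochEnd {τ : ℕ} (hτ : 2 ≤ τ) (m : ℕ) : m ≤ epochEnd τ m := by
  cases m with
  | zero => simp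
  | succ m =>
    rw [epochEnd_succ]
    have := (Nat.lt_two_pow_self (n := m))
    nlinarith

lemma exists_epoch {τ : ℕ} (hτ : 2 ≤ τ) {s : ℕ} (hs : 1 ≤ s) :
    ∃ m, 1 ≤ m ∧ epochEnd τ (m - 1) < s ∧ s ≤ epochEnd τ m := by
  classical
  have h : ∃ m, s ≤ epochEnd τ m := ⟨s, lt_epochEnd hτ s⟩
  have h1 : 1 ≤ Nat.find h := by
    by_contra h0
    have h2 := Nat.find_spec h
    rw [show Nat.find h = 0 by omega] at h2
    simp [epochEnd] at h2; omega
  refine ⟨Nat.find h, h1, ?_, Nat.find_spec h⟩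
  exact not_le.1 (Nat.find_min h (m := Nat.find h - 1) (by omega))

end Epochs

/-! ### Dependence of the algorithm on the past only -/

namespace ModIGW

variable {𝒳 𝒜 : Type*} [MeasurableSpace 𝒳] [MeasurableSpace 𝒜] {M : ℕ} (alg : ModIGW 𝒳 𝒜 M)

lemma sample_congr {z z' : ℕ → Obs 𝒳 𝒜} {m : ℕ}
    (h : ∀ s, 1 ≤ s → s ≤ epochEnd alg.τ₁ m → z s = z' s) :
    alg.sample z m = alg.sample z' m := by
  funext k
  refine h _ (by omega) ?_
  have := epochEnd_pred_add_epochLength alg.τ₁ m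
  omega

lemma indexSet_congr {z z' : ℕ → Obs 𝒳 𝒜} : ∀ {m : ℕ},
    (∀ s, 1 ≤ s → s ≤ epochEnd alg.τ₁ (m - 1) → z s = z' s) →
    alg.indexSet z m = alg.indexSet z' m
  | 0, _ => rfl
  | 1, _ => rfl
  | m + 2, h => by
    rw [indexSet, indexSet, alg.sample_congr (m := m + 1) h,
      indexSet_congr fun s h1 h2 => h s h1 (h2.trans (epochEnd_mono _ (by omega)))]

lemma fitted_congr {z z' : ℕ → Obs 𝒳 𝒜} {m : ℕ}
    (h : ∀ s, 1 ≤ s → s ≤ epochEnd alg.τ₁ (m - 1) → z s = z' s) [NeZero M] :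
    alg.fitted z m = alg.fitted z' m := by
  obtain _ | _ | m := m
  · rfl
  · rfl
  · rw [fitted, fitted, alg.sample_congr (m := m + 1) h]

lemma gamma_congr {z z' : ℕ → Obs 𝒳 𝒜} [Fintype 𝒜] [NeZero M] {m : ℕ}
    (h : ∀ s, 1 ≤ s → s ≤ epochEnd alg.τ₁ (m - 1) → z s = z' s) :
    alg.gamma z m = alg.gamma z' m := by
  obtain _ | _ | m := m
  · rfl
  · rfl
  · rw [gamma, gamma, index, index, alg.indexSet_congr h]

lemma actionProb_congr {z z' : ℕ → Obs 𝒳 𝒜} [Fintype 𝒜] [DecidableEq 𝒜] [NeZero M] {m : ℕ}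
    (h : ∀ s, 1 ≤ s → s ≤ epochEnd alg.τ₁ (m - 1) → z s = z' s) :
    alg.actionProb z m = alg.actionProb z' m := by
  funext x a
  have hb : alg.bestArm z m x = alg.bestArm z' m x := by rw [bestArm, bestArm, alg.fitted_congr h]
  have hi : alg.igw z m x = alg.igw z' m x := by
    funext a
    rw [igw, igw, hb, alg.fitted_congr h, alg.gamma_congr h]
  by_cases h' : a = alg.bestArm z' m x <;> simp [actionProb, hb, hi, h']

/-! ### Measurability of the algorithm -/

lemma measurable_sample (m : ℕ) : Measurable fun z : ℕ → Obs 𝒳 𝒜 => alg.sample z m :=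
  measurable_pi_lambda _ fun _ => measurable_pi_apply _

lemma measurableSet_mem_indexSet (i : Fin M) : ∀ m : ℕ,
    MeasurableSet {z : ℕ → Obs 𝒳 𝒜 | i ∈ alg.indexSet z m}
  | 0 => by simp [indexSet]
  | 1 => by simp [indexSet]
  | m + 2 => by
    have h : {z : ℕ → Obs 𝒳 𝒜 | i ∈ alg.indexSet z (m + 2)} =
        {z | i ∈ alg.indexSet z (m + 1)} ∩ (fun z => alg.mt.test i _ (alg.sample z (m + 1))
          (alg.conf (m + 1))) ⁻¹' {false} := by
      ext z; simp [indexSet]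
    rw [h]
    exact (measurableSet_mem_indexSet i (m + 1)).inter
      (((alg.mt.measurable_test i _ _).comp (alg.measurable_sample _)) (measurableSet_singleton _))

/-- The index factors through the vector of membership indicators, which lives in a finite space,
where every function is measurable. -/
lemma measurable_index [NeZero M] (m : ℕ) : Measurable fun z : ℕ → Obs 𝒳 𝒜 => alg.index z m := by
  classical
  let G : (Fin M → Prop) → Fin M := fun v =>
    if h : (Finset.univ.filter v).Nonempty then (Finset.univ.filter v).min' h else ⊤
  have hG : Measurable G := measurable_of_finite G
  have h : (fun z : ℕ → Obs 𝒳 𝒜 => alg.index z m) = fun z => G fun i => i ∈ alg.indexSet z m := by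
    funext z
    simp only [G, index, Finset.filter_mem_eq_inter, Finset.univ_inter]
  rw [h]
  exact hG.comp (measurable_pi_lambda _ fun i =>
    measurableSet_setOfPred.1 (alg.measurableSet_mem_indexSet i m))

lemma measurable_gamma [NeZero M] [Fintype 𝒜] (m : ℕ) :
    Measurable fun z : ℕ → Obs 𝒳 𝒜 => alg.gamma z m := by
  obtain _ | _ | m := m
  · exact measurable_const
  · exact measurable_const
  · exact (measurable_of_finite (alg.gammaClass (m + 1))).comp (alg.measurable_index _)

lemma measurable_fitted [NeZero M] (m : ℕ) (a : 𝒜) :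
    Measurable fun q : (ℕ → Obs 𝒳 𝒜) × 𝒳 => alg.fitted q.1 m q.2 a := by
  refine measurable_subtype_coe.comp ?_
  obtain _ | _ | m := m
  · exact measurable_const
  · exact measurable_const
  · exact ((alg.est ⊤).measurable_fit _ a).comp
      (((alg.measurable_sample _).comp measurable_fst).prodMk measurable_snd)

lemma measurable_bestArm [NeZero M] (m : ℕ) :
    Measurable fun q : (ℕ → Obs 𝒳 𝒜) × 𝒳 => alg.bestArm q.1 m q.2 :=
  alg.best.measurable_pick.comp (measurable_pi_lambda _ fun a => alg.measurable_fitted m a)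

variable [Fintype 𝒜] [DecidableEq 𝒜] [MeasurableSingletonClass 𝒜] [NeZero M]

lemma measurable_igw (m : ℕ) (a : 𝒜) :
    Measurable fun q : (ℕ → Obs 𝒳 𝒜) × 𝒳 => alg.igw q.1 m q.2 a := by
  have h : Measurable fun q : (ℕ → Obs 𝒳 𝒜) × 𝒳 =>
      alg.fitted q.1 m q.2 (alg.bestArm q.1 m q.2) := by
    have h1 : Measurable fun q : ((ℕ → Obs 𝒳 𝒜) × 𝒳) × 𝒜 =>
        (alg.fitted q.1.1 m q.1.2 q.2 : ℝ) :=
      measurable_from_prod_countable_left fun a => alg.measurable_fitted m a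
    exact h1.comp (measurable_id.prodMk (alg.measurable_bestArm m))
  exact measurable_const.div (measurable_const.add
    (((alg.measurable_gamma m).comp measurable_fst).mul (h.sub (alg.measurable_fitted m a))))

lemma measurable_actionProb (m : ℕ) (a : 𝒜) :
    Measurable fun q : (ℕ → Obs 𝒳 𝒜) × 𝒳 => alg.actionProb q.1 m q.2 a := by
  unfold actionProb
  refine Measurable.ite ?_ ?_ (alg.measurable_igw m a)
  · exact measurableSet_eq_fun measurable_const (alg.measurable_bestArm m)
  -- The range of summation depends on the sample through the best arm; summing over all arms with a
  -- zero at the best one makes the range fixed.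
  · have h : (fun q : (ℕ → Obs 𝒳 𝒜) × 𝒳 =>
        1 - ∑ a' ∈ Finset.univ.erase (alg.bestArm q.1 m q.2), alg.igw q.1 m q.2 a') =
        fun q => 1 - ∑ a', if alg.bestArm q.1 m q.2 = a' then 0 else alg.igw q.1 m q.2 a' := by
      funext q
      rw [← Finset.filter_ne, Finset.sum_filter]
      congr 1
      exact Finset.sum_congr rfl fun b _ => by by_cases hb : alg.bestArm q.1 m q.2 = b <;> simp [hb]
    rw [h]
    refine measurable_const.sub (Finset.measurable_sum _ fun b _ => Measurable.ite ?_
      measurable_const (alg.measurable_igw m b))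
    exact measurableSet_eq_fun (alg.measurable_bestArm m) measurable_const

end ModIGW

/-! ### Gaps and the inverse gap weighting distribution -/

/-- The gap between the arm selected by `best` for the model `f` and the arm `a`. -/
def gap {𝒳 𝒜 : Type*} [MeasurableSpace 𝒳] [MeasurableSpace 𝒜] (best : ArgmaxRule 𝒜)
    (f : Model 𝒳 𝒜) (x : 𝒳) (a : 𝒜) : ℝ :=
  f x (best.pick (f x)) - f x a

section Gap

variable {𝒳 𝒜 : Type*} [MeasurableSpace 𝒳] [MeasurableSpace 𝒜] (best : ArgmaxRule 𝒜)
  (f : Model 𝒳 𝒜)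

lemma Model.nonneg (x : 𝒳) (a : 𝒜) : 0 ≤ f x a := (f.toFun x a).2.1

lemma Model.le_one (x : 𝒳) (a : 𝒜) : f x a ≤ 1 := (f.toFun x a).2.2

lemma Model.abs_sub_le_one (g : Model 𝒳 𝒜) (x : 𝒳) (a : 𝒜) : |f x a - g x a| ≤ 1 :=
  abs_sub_le_of_nonneg_of_le (f.nonneg x a) (f.le_one x a) (g.nonneg x a) (g.le_one x a)

lemma Model.measurable_apply (a : 𝒜) : Measurable fun x => f x a :=
  measurable_subtype_coe.comp (f.measurable_toFun a)

lemma gap_nonneg (x : 𝒳) (a : 𝒜) : 0 ≤ gap best f x a := sub_nonneg.2 (best.le_pick (f x) a)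

lemma gap_le_one (x : 𝒳) (a : 𝒜) : gap best f x a ≤ 1 := by
  have h1 := f.nonneg x a
  have h2 := f.le_one x (best.pick (f x))
  unfold gap; linarith

lemma measurable_pick_model : Measurable fun x => best.pick (f x) :=
  best.measurable_pick.comp (measurable_pi_lambda _ fun a => f.measurable_apply a)

lemma measurable_gap [Countable 𝒜] [MeasurableSingletonClass 𝒜] (a : 𝒜) :
    Measurable fun x => gap best f x a := by
  have h1 : Measurable fun q : 𝒳 × 𝒜 => (f q.1 q.2 : ℝ) :=
    measurable_from_prod_countable_left fun a => f.measurable_apply a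
  exact (h1.comp (measurable_id.prodMk (measurable_pick_model best f))).sub (f.measurable_apply a)

end Gap

/-- A (randomized) policy, given by its action probabilities. -/
structure IsPolicy {𝒳 𝒜 : Type*} [MeasurableSpace 𝒳] [Fintype 𝒜] (Q : 𝒳 → 𝒜 → ℝ) : Prop where
  measurable : ∀ a, Measurable fun x => Q x a
  nonneg : ∀ x a, 0 ≤ Q x a
  sum_eq_one : ∀ x, ∑ a, Q x a = 1

namespace ModIGW

variable {𝒳 𝒜 : Type*} [MeasurableSpace 𝒳] [MeasurableSpace 𝒜] {M : ℕ} (alg : ModIGW 𝒳 𝒜 M)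
  [Fintype 𝒜] [DecidableEq 𝒜] [NeZero M]

lemma gamma_nonneg (z : ℕ → Obs 𝒳 𝒜) (m : ℕ) : 0 ≤ alg.gamma z m := by
  obtain _ | _ | m := m
  · exact zero_le_one
  · exact zero_le_one
  · exact Real.sqrt_nonneg _

variable [Nonempty 𝒜]

lemma card_add_gamma_mul_gap_pos (z : ℕ → Obs 𝒳 𝒜) (m : ℕ) (x : 𝒳) (a : 𝒜) :
    0 < Fintype.card 𝒜 + alg.gamma z m * gap alg.best (alg.fitted z m) x a := by
  have h1 : (0 : ℝ) < Fintype.card 𝒜 := by exact_mod_cast Fintype.card_pos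
  have h2 := mul_nonneg (alg.gamma_nonneg z m) (gap_nonneg alg.best (alg.fitted z m) x a)
  linarith

lemma igw_eq (z : ℕ → Obs 𝒳 𝒜) (m : ℕ) (x : 𝒳) (a : 𝒜) :
    alg.igw z m x a =
      1 / (Fintype.card 𝒜 + alg.gamma z m * gap alg.best (alg.fitted z m) x a) := rfl

lemma igw_le (z : ℕ → Obs 𝒳 𝒜) (m : ℕ) (x : 𝒳) (a : 𝒜) :
    alg.igw z m x a ≤ 1 / Fintype.card 𝒜 := by
  have h1 : (0 : ℝ) < Fintype.card 𝒜 := by exact_mod_cast Fintype.card_pos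
  have h2 := mul_nonneg (alg.gamma_nonneg z m) (gap_nonneg alg.best (alg.fitted z m) x a)
  rw [igw_eq]
  exact one_div_le_one_div_of_le h1 (by linarith)

lemma inv_card_le_actionProb_bestArm (z : ℕ → Obs 𝒳 𝒜) (m : ℕ) (x : 𝒳) :
    1 / (Fintype.card 𝒜 : ℝ) ≤ alg.actionProb z m x (alg.bestArm z m x) := by
  have h1 : (0 : ℝ) < Fintype.card 𝒜 := by exact_mod_cast Fintype.card_pos
  have h2 : ∑ a' ∈ Finset.univ.erase (alg.bestArm z m x), alg.igw z m x a' ≤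
      ∑ a' ∈ Finset.univ.erase (alg.bestArm z m x), 1 / (Fintype.card 𝒜 : ℝ) :=
    Finset.sum_le_sum fun a _ => alg.igw_le z m x a
  have h3 : ∑ a' ∈ Finset.univ.erase (alg.bestArm z m x), 1 / (Fintype.card 𝒜 : ℝ) =
      1 - 1 / (Fintype.card 𝒜 : ℝ) := by
    rw [Finset.sum_erase_eq_sub (Finset.mem_univ _)]
    simp
  rw [actionProb, if_pos rfl]
  linarith

/-- Equality holds away from the predicted best arm. At that arm the gap is zero, and its
probability is at least 1/K because each other arm receives at most 1/K. This exploration bound is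
what allows a change of policy in the error estimates. -/
lemma one_le_actionProb_mul (z : ℕ → Obs 𝒳 𝒜) (m : ℕ) (x : 𝒳) (a : 𝒜) :
    1 ≤ alg.actionProb z m x a *
      (Fintype.card 𝒜 + alg.gamma z m * gap alg.best (alg.fitted z m) x a) := by
  by_cases h : a = alg.bestArm z m x
  · subst h
    have h1 : (0 : ℝ) < Fintype.card 𝒜 := by exact_mod_cast Fintype.card_pos
    have h2 := alg.inv_card_le_actionProb_bestArm z m x
    have h3 : gap alg.best (alg.fitted z m) x (alg.bestArm z m x) = 0 := sub_self _
    rw [h3, mul_zero, add_zero]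
    exact (div_le_iff₀ h1).1 h2
  · rw [actionProb, if_neg h, igw_eq, one_div_mul_cancel (alg.card_add_gamma_mul_gap_pos z m x a).ne']

lemma actionProb_nonneg (z : ℕ → Obs 𝒳 𝒜) (m : ℕ) (x : 𝒳) (a : 𝒜) :
    0 ≤ alg.actionProb z m x a :=
  (pos_of_mul_pos_left (one_pos.trans_le (alg.one_le_actionProb_mul z m x a))
    (alg.card_add_gamma_mul_gap_pos z m x a).le).le

lemma isPolicy_actionProb [MeasurableSingletonClass 𝒜] (z : ℕ → Obs 𝒳 𝒜) (m : ℕ) :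
    IsPolicy (alg.actionProb z m) where
  measurable a := (alg.measurable_actionProb m a).comp (measurable_const.prodMk measurable_id)
  nonneg := alg.actionProb_nonneg z m
  sum_eq_one x := by
    have h : ∀ a ∈ Finset.univ.erase (alg.bestArm z m x),
        alg.actionProb z m x a = alg.igw z m x a :=
      fun a ha => if_neg (Finset.ne_of_mem_erase ha)
    rw [← Finset.add_sum_erase _ _ (Finset.mem_univ (alg.bestArm z m x)), Finset.sum_congr rfl h,
      actionProb, if_pos rfl, sub_add_cancel]

/-- Inverse gap weighting has small regret with respect to its own model. -/
lemma gamma_mul_sum_actionProb_mul_gap_le (z : ℕ → Obs 𝒳 𝒜) (m : ℕ) (x : 𝒳) :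
    alg.gamma z m * ∑ a, alg.actionProb z m x a * gap alg.best (alg.fitted z m) x a ≤
      Fintype.card 𝒜 := by
  rw [Finset.mul_sum]
  calc _ ≤ ∑ _a : 𝒜, (1 : ℝ) := Finset.sum_le_sum fun a _ => ?_
    _ = _ := by simp
  by_cases h : a = alg.bestArm z m x
  · subst h
    have h3 : gap alg.best (alg.fitted z m) x (alg.bestArm z m x) = 0 := sub_self _
    simp [h3]
  · have h1 := alg.card_add_gamma_mul_gap_pos z m x a
    have h2 : (0 : ℝ) < Fintype.card 𝒜 := by exact_mod_cast Fintype.card_pos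
    rw [actionProb, if_neg h, igw_eq]
    rw [show ∀ g p q : ℝ, g * (1 / p * q) = g * q / p from fun g p q => by ring, div_le_one h1]
    linarith

end ModIGW
end ContextualBandit

namespace ContextualBandit

/-! ### Laws of policies and observations -/

/-- The defining identity of the conditional probability on sets of `m` extends to nonnegative
`m`-measurable functions by linearity and monotone limits. Working with `lintegral` avoids all
integrability conditions on `G`. -/
lemma lintegral_indicator_eq_of_condExp {Ω : Type*} {m m0 : MeasurableSpace Ω} (hm : m ≤ m0)
    {P : Measure Ω} [IsFiniteMeasure P] {A : Set Ω} (hA : MeasurableSet A) {w : Ω → ℝ}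
    (hw : P[A.indicator (fun _ => (1 : ℝ)) | m] =ᵐ[P] w) {G : Ω → ℝ≥0∞}
    (hG : Measurable[m] G) :
    ∫⁻ ω in A, G ω ∂P = ∫⁻ ω, ENNReal.ofReal (w ω) * G ω ∂P := by
  have hint : Integrable (A.indicator (fun _ => (1 : ℝ))) P := (integrable_const 1).indicator hA
  have hw0 : 0 ≤ᵐ[P] w := by
    have h : 0 ≤ᵐ[P] P[A.indicator (fun _ => (1 : ℝ)) | m] :=
      condExp_nonneg (ae_of_all _ fun ω => Set.indicator_nonneg (fun _ _ => zero_le_one) ω)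
    filter_upwards [h, hw] with ω h1 h2
    rwa [← h2]
  have hwi : Integrable w P := integrable_condExp.congr hw
  have hwm : AEMeasurable (fun ω => ENNReal.ofReal (w ω)) P :=
    hwi.aestronglyMeasurable.aemeasurable.ennreal_ofReal
  refine Measurable.ennreal_induction (motive := fun G =>
    ∫⁻ ω in A, G ω ∂P = ∫⁻ ω, ENNReal.ofReal (w ω) * G ω ∂P) ?_ ?_ ?_ hG
  · intro c s hs
    have h1 : ∫⁻ ω in s, ENNReal.ofReal (w ω) ∂P = P (s ∩ A) := by
      rw [← ofReal_integral_eq_lintegral_ofReal hwi.restrict (ae_restrict_of_ae hw0),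
        setIntegral_congr_ae (hm s hs) (hw.mono fun ω h _ => h.symm),
        setIntegral_condExp hm hint hs, setIntegral_indicator hA]
      simp
    simp_rw [← Set.indicator_mul_right s (fun ω => ENNReal.ofReal (w ω)) (g := fun _ => c)]
    rw [lintegral_indicator (hm s hs), lintegral_indicator (hm s hs),
      lintegral_mul_const'' _ hwm.restrict, h1, lintegral_const,
      Measure.restrict_restrict (hm s hs), Measure.restrict_apply_univ, mul_comm]
  · intro f g _ hf hg hf' hg'
    simp only [Pi.add_apply, mul_add]
    rw [lintegral_add_left (hf.mono hm le_rfl), hf', hg',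
      lintegral_add_left' (f := fun ω => ENNReal.ofReal (w ω) * f ω) (hwm.mul (hf.mono hm le_rfl).aemeasurable)]
  · intro f hf hmono ih
    simp only [ENNReal.mul_iSup]
    rw [lintegral_iSup (fun n => (hf n).mono hm le_rfl) hmono,
      lintegral_iSup' (f := fun n ω => ENNReal.ofReal (w ω) * f n ω) (fun n => hwm.mul ((hf n).mono hm le_rfl).aemeasurable)
        (ae_of_all _ fun ω i j hij => mul_le_mul_right (hmono hij ω) _)]
    exact iSup_congr ih

namespace IsPolicy

variable {𝒳 𝒜 : Type*} [MeasurableSpace 𝒳] [MeasurableSpace 𝒜] [Fintype 𝒜]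
  {Q : 𝒳 → 𝒜 → ℝ}

/-- The kernel of a policy. -/
def kernel (hQ : IsPolicy Q) : Kernel 𝒳 𝒜 where
  toFun x := ∑ a, ENNReal.ofReal (Q x a) • Measure.dirac a
  measurable' := by
    refine Measure.measurable_of_measurable_coe _ fun s _ => ?_
    simp only [Measure.coe_finsetSum, Finset.sum_apply, Measure.smul_apply, smul_eq_mul]
    exact Finset.measurable_sum _ fun a _ => (hQ.measurable a).ennreal_ofReal.mul_const _

lemma kernel_apply (hQ : IsPolicy Q) (x : 𝒳) :
    hQ.kernel x = ∑ a, ENNReal.ofReal (Q x a) • Measure.dirac a := rfl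

lemma isMarkovKernel (hQ : IsPolicy Q) : IsMarkovKernel hQ.kernel := by
  refine ⟨fun x => ⟨?_⟩⟩
  rw [kernel_apply]
  simp only [Measure.coe_finsetSum, Finset.sum_apply, Measure.smul_apply, smul_eq_mul,
    measure_univ, mul_one]
  rw [← ENNReal.ofReal_sum_of_nonneg fun a _ => hQ.nonneg x a, hQ.sum_eq_one, ENNReal.ofReal_one]

variable [MeasurableSingletonClass 𝒜]

lemma lintegral_kernel (hQ : IsPolicy Q) (x : 𝒳) (g : 𝒜 → ℝ≥0∞) :
    ∫⁻ a, g a ∂hQ.kernel x = ∑ a, ENNReal.ofReal (Q x a) * g a := by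
  rw [kernel_apply, lintegral_finsetSum_measure]
  simp [lintegral_smul_measure]

lemma integral_kernel (hQ : IsPolicy Q) (x : 𝒳) (g : 𝒜 → ℝ) :
    ∫ a, g a ∂hQ.kernel x = ∑ a, Q x a * g a := by
  rw [kernel_apply, integral_finsetSum_measure]
  · simp [integral_smul_measure, ENNReal.toReal_ofReal (hQ.nonneg x _)]
  · intro a _
    exact (integrable_dirac (by finiteness)).smul_measure ENNReal.ofReal_ne_top

lemma measurable_obs : Measurable
    fun q : (𝒳 × (𝒜 → unitInterval)) × 𝒜 => ((q.1.1, q.2, q.1.2 q.2) : Obs 𝒳 𝒜) := by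
  refine measurable_from_prod_countable_left fun a => ?_
  exact measurable_fst.prodMk (measurable_const.prodMk ((measurable_pi_apply a).comp measurable_snd))

lemma lintegral_obsLaw (hQ : IsPolicy Q) (D : Measure (𝒳 × (𝒜 → unitInterval))) [SFinite D]
    {g : Obs 𝒳 𝒜 → ℝ≥0∞} (hg : Measurable g) :
    ∫⁻ o, g o ∂obsLaw D hQ.kernel =
      ∫⁻ q, ∑ b, ENNReal.ofReal (Q q.1 b) * g (q.1, b, q.2 b) ∂D := by
  have := hQ.isMarkovKernel
  rw [obsLaw, lintegral_map hg measurable_obs, Measure.lintegral_compProd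
    (f := fun q : (𝒳 × (𝒜 → unitInterval)) × 𝒜 => g (q.1.1, q.2, q.1.2 q.2)) (hg.comp measurable_obs)]
  simp only [Kernel.comap_apply, lintegral_kernel]

lemma isProbabilityMeasure_obsLaw (hQ : IsPolicy Q) (D : Measure (𝒳 × (𝒜 → unitInterval)))
    [IsProbabilityMeasure D] : IsProbabilityMeasure (obsLaw D hQ.kernel) := by
  have := hQ.isMarkovKernel
  exact Measure.isProbabilityMeasure_map measurable_obs.aemeasurable

end IsPolicy

/-! ### One round of a run -/

section Round

variable {𝒳 𝒜 Ω : Type*} [MeasurableSpace 𝒳] [MeasurableSpace 𝒜] [mΩ : MeasurableSpace Ω]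
  {x : ℕ → Ω → 𝒳} {r : ℕ → Ω → 𝒜 → unitInterval} {a : ℕ → Ω → 𝒜}

/-- The observations up to round `N`, followed by an arbitrary constant. -/
def truncate (o : Obs 𝒳 𝒜) (N : ℕ) (z : ℕ → Obs 𝒳 𝒜) : ℕ → Obs 𝒳 𝒜 :=
  fun s => if 1 ≤ s ∧ s ≤ N then z s else o

lemma measurable_round_past {s t : ℕ} (h1 : 1 ≤ s) (h2 : s < t) :
    Measurable[past x r a t] fun ω => (x s ω, r s ω, a s ω) := by
  have h : MeasurableSpace.comap (fun ω => (x s ω, r s ω, a s ω)) inferInstance ≤ past x r a t :=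
    le_iSup₂_of_le s ⟨h1, h2⟩ le_rfl
  exact (comap_measurable _).mono h le_rfl

variable [Fintype 𝒜] [DecidableEq 𝒜] [MeasurableSingletonClass 𝒜]

lemma measurable_observations_past {s t : ℕ} (h1 : 1 ≤ s) (h2 : s < t) :
    Measurable[past x r a t] fun ω => observations x r a ω s := by
  have h : Measurable fun q : 𝒳 × (𝒜 → unitInterval) × 𝒜 => ((q.1, q.2.2, q.2.1 q.2.2) : Obs 𝒳 𝒜) :=
    IsPolicy.measurable_obs.comp
      ((measurable_fst.prodMk measurable_snd.fst).prodMk measurable_snd.snd)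
  exact h.comp (measurable_round_past h1 h2)

/-- The full sequence of observations is not measurable with respect to the past, but its truncation
is. Since the kernel of an epoch depends only on the earlier epochs, truncating at the end of the
preceding epoch leaves it unchanged, so it becomes a past-measurable random kernel. -/
lemma measurable_truncate_past (o : Obs 𝒳 𝒜) {N t : ℕ} (h : N < t) :
    Measurable[past x r a t] fun ω => truncate o N (observations x r a ω) := by
  refine @measurable_pi_lambda _ _ _ (past x r a t) _ _ fun s => ?_
  by_cases hs : 1 ≤ s ∧ s ≤ N
  · simp only [truncate, if_pos hs]
    exact measurable_observations_past hs.1 (hs.2.trans_lt h)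
  · simp only [truncate, if_neg hs]
    exact measurable_const

variable [Nonempty 𝒜] {M : ℕ} [NeZero M] {alg : ModIGW 𝒳 𝒜 M}
  {D : Measure (𝒳 × (𝒜 → unitInterval))} {P : Measure Ω}

lemma IsRun.past_le (h : IsRun alg D P x r a) (t : ℕ) : past x r a t ≤ mΩ :=
  iSup₂_le fun s _ => ((h.measurable_context s).prodMk
    ((h.measurable_reward s).prodMk (h.measurable_arm s))).comap_le

lemma IsRun.draw_le (h : IsRun alg D P x r a) (t : ℕ) : draw x r t ≤ mΩ :=
  ((h.measurable_context t).prodMk (h.measurable_reward t)).comap_le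

lemma IsRun.measurable_observations (h : IsRun alg D P x r a) (s : ℕ) :
    Measurable fun ω => observations x r a ω s :=
  IsPolicy.measurable_obs.comp
    (((h.measurable_context s).prodMk (h.measurable_reward s)).prodMk (h.measurable_arm s))

lemma IsRun.measurable_observations' (h : IsRun alg D P x r a) :
    Measurable fun ω => observations x r a ω :=
  measurable_pi_lambda _ h.measurable_observations

/-- The kernel by which the arms of epoch `m` are drawn. -/
def ModIGW.actionKernel (alg : ModIGW 𝒳 𝒜 M) (z : ℕ → Obs 𝒳 𝒜) (m : ℕ) : Kernel 𝒳 𝒜 :=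
  (alg.isPolicy_actionProb z m).kernel

instance (alg : ModIGW 𝒳 𝒜 M) (z : ℕ → Obs 𝒳 𝒜) (m : ℕ) :
    IsMarkovKernel (alg.actionKernel z m) :=
  (alg.isPolicy_actionProb z m).isMarkovKernel

instance (alg : ModIGW 𝒳 𝒜 M) (z : ℕ → Obs 𝒳 𝒜) (m : ℕ) [IsProbabilityMeasure D] :
    IsProbabilityMeasure (obsLaw D (alg.actionKernel z m)) :=
  (alg.isPolicy_actionProb z m).isProbabilityMeasure_obsLaw D

lemma ModIGW.actionKernel_congr (alg : ModIGW 𝒳 𝒜 M) {z z' : ℕ → Obs 𝒳 𝒜} {m : ℕ}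
    (h : ∀ s, 1 ≤ s → s ≤ epochEnd alg.τ₁ (m - 1) → z s = z' s) :
    alg.actionKernel z m = alg.actionKernel z' m := by
  ext1 x
  simp only [actionKernel, IsPolicy.kernel_apply, alg.actionProb_congr h]

lemma truncate_agrees (o : Obs 𝒳 𝒜) (N : ℕ) (z : ℕ → Obs 𝒳 𝒜) :
    ∀ s, 1 ≤ s → s ≤ N → truncate o N z s = z s :=
  fun _ h1 h2 => if_pos ⟨h1, h2⟩

lemma ModIGW.measurable_lintegral_obsLaw (alg : ModIGW 𝒳 𝒜 M) [IsProbabilityMeasure D] (m : ℕ)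
    {𝒴 : Type*} [MeasurableSpace 𝒴] {g : 𝒴 × Obs 𝒳 𝒜 → ℝ≥0∞} (hg : Measurable g) :
    Measurable fun q : 𝒴 × (ℕ → Obs 𝒳 𝒜) =>
      ∫⁻ o, g (q.1, o) ∂obsLaw D (alg.actionKernel q.2 m) := by
  have h : ∀ q : 𝒴 × (ℕ → Obs 𝒳 𝒜), ∫⁻ o, g (q.1, o) ∂obsLaw D (alg.actionKernel q.2 m) =
      ∫⁻ p, ∑ b, ENNReal.ofReal (alg.actionProb q.2 m p.1 b) * g (q.1, p.1, b, p.2 b) ∂D :=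
    fun q => IsPolicy.lintegral_obsLaw (alg.isPolicy_actionProb q.2 m) D
      (hg.comp measurable_prodMk_left)
  simp only [h]
  refine Measurable.lintegral_prod_right' (f := fun p : (𝒴 × (ℕ → Obs 𝒳 𝒜)) ×
    (𝒳 × (𝒜 → unitInterval)) => ∑ b, ENNReal.ofReal (alg.actionProb p.1.2 m p.2.1 b) *
      g (p.1.1, p.2.1, b, p.2.2 b)) ?_
  refine Finset.measurable_sum _ fun b _ => Measurable.mul ?_ ?_
  · exact ((alg.measurable_actionProb m b).comp
      (measurable_fst.snd.prodMk measurable_snd.fst)).ennreal_ofReal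
  · exact hg.comp (measurable_fst.fst.prodMk (measurable_snd.fst.prodMk
      (measurable_const.prodMk ((measurable_pi_apply b).comp measurable_snd.snd))))

/-- Given the past, the observation of a round of epoch `m` is distributed according to the action
kernel of that epoch. -/
lemma IsRun.lintegral_observation [IsProbabilityMeasure D] [IsProbabilityMeasure P]
    (h : IsRun alg D P x r a) {m t : ℕ}
    (hm : 1 ≤ m) (ht : epochEnd alg.τ₁ (m - 1) < t) (ht' : t ≤ epochEnd alg.τ₁ m)
    {𝒴 : Type*} [MeasurableSpace 𝒴] {Y : Ω → 𝒴} (hY : Measurable[past x r a t] Y)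
    {g : 𝒴 × Obs 𝒳 𝒜 → ℝ≥0∞} (hg : Measurable g) :
    ∫⁻ ω, g (Y ω, observations x r a ω t) ∂P =
      ∫⁻ ω, ∫⁻ o, g (Y ω, o) ∂obsLaw D (alg.actionKernel (observations x r a ω) m) ∂P := by
  obtain ⟨⟨x₀, -⟩⟩ : Nonempty (𝒳 × (𝒜 → unitInterval)) := nonempty_of_isProbabilityMeasure D
  let o : Obs 𝒳 𝒜 := (x₀, Classical.arbitrary 𝒜, 0)
  have hpast := h.past_le t
  have hdraw := h.draw_le t
  let Z : Ω → 𝒴 × (ℕ → Obs 𝒳 𝒜) := fun ω =>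
    (Y ω, truncate o (epochEnd alg.τ₁ (m - 1)) (observations x r a ω))
  have hZ : Measurable[past x r a t] Z := hY.prodMk (measurable_truncate_past o ht)
  let W : Ω → 𝒳 × (𝒜 → unitInterval) := fun ω => (x t ω, r t ω)
  have hW : Measurable[draw x r t] W := comap_measurable _
  have hW' : Measurable W := hW.mono hdraw le_rfl
  have hZ' : Measurable Z := hZ.mono hpast le_rfl
  have hcongr : ∀ z, alg.actionProb (truncate o (epochEnd alg.τ₁ (m - 1)) z) m =
      alg.actionProb z m := fun z => alg.actionProb_congr (truncate_agrees o _ z)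
  -- the contribution of one arm
  let G : 𝒜 → (𝒴 × (ℕ → Obs 𝒳 𝒜)) × (𝒳 × (𝒜 → unitInterval)) → ℝ≥0∞ := fun b q =>
    ENNReal.ofReal (alg.actionProb q.1.2 m q.2.1 b) * g (q.1.1, q.2.1, b, q.2.2 b)
  have hg' : ∀ b, Measurable fun q : (𝒴 × (ℕ → Obs 𝒳 𝒜)) × (𝒳 × (𝒜 → unitInterval)) =>
      g (q.1.1, q.2.1, b, q.2.2 b) := fun b =>
    hg.comp (measurable_fst.fst.prodMk (measurable_snd.fst.prodMk
      (measurable_const.prodMk ((measurable_pi_apply b).comp measurable_snd.snd))))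
  have hG : ∀ b, Measurable (G b) := fun b =>
    (((alg.measurable_actionProb m b).comp
      (measurable_fst.snd.prodMk measurable_snd.fst)).ennreal_ofReal).mul (hg' b)
  have harm : ∀ b, ∫⁻ ω in a t ⁻¹' {b}, g (Y ω, observations x r a ω t) ∂P =
      ∫⁻ ω, G b (Z ω, W ω) ∂P := by
    intro b
    have hb : MeasurableSet (a t ⁻¹' {b}) := h.measurable_arm t (measurableSet_singleton b)
    -- Where arm `b` is drawn, the observation is a function of the past and the current draw alone,
    -- so the event can be replaced by its conditional probability.
    rw [setLIntegral_congr_fun (g := fun ω => g (Y ω, x t ω, b, r t ω b)) hb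
      (fun ω (hω : a t ω = b) => by simp only [observations, hω])]
    rw [lintegral_indicator_eq_of_condExp (sup_le hpast hdraw) hb (h.law_arm m hm t ht ht' b)]
    · simp only [G, Z, W, hcongr]
    · have hZW : Measurable[past x r a t ⊔ draw x r t] fun ω => (Z ω, W ω) :=
        (hZ.mono le_sup_left le_rfl).prodMk (hW.mono le_sup_right le_rfl)
      exact (hg' b).comp hZW
  have hsplit : ∫⁻ ω, g (Y ω, observations x r a ω t) ∂P =
      ∑ b, ∫⁻ ω in a t ⁻¹' {b}, g (Y ω, observations x r a ω t) ∂P := by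
    rw [← setLIntegral_univ, ← Set.preimage_univ (f := a t), ← Set.iUnion_of_singleton,
      Set.preimage_iUnion, lintegral_iUnion (fun b => h.measurable_arm t (measurableSet_singleton b)),
      tsum_fintype]
    intro b c hbc
    exact (Set.disjoint_singleton.2 hbc).preimage _
  -- `Z` contains both `Y` and what determines the kernel. It is past-measurable and hence
  -- independent of the draw; Fubini then integrates out the draw with the kernel frozen.
  have hind : P.map (fun ω => (Z ω, W ω)) = (P.map Z).prod D := by
    have h1 : IndepFun Z W P := by
      rw [IndepFun_iff_Indep]
      exact (indep_of_indep_of_le_right (h.indep_draw t (by omega)).symm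
        (hW.comap_le)) |> fun h2 => indep_of_indep_of_le_left h2 hZ.comap_le
    rw [(indepFun_iff_map_prod_eq_prod_map_map hZ'.aemeasurable hW'.aemeasurable).1 h1,
      h.law_draw t (by omega)]
  have hsum : Measurable fun q : (𝒴 × (ℕ → Obs 𝒳 𝒜)) × (𝒳 × (𝒜 → unitInterval)) => ∑ b, G b q :=
    Finset.measurable_sum _ fun b _ => hG b
  rw [hsplit, Finset.sum_congr rfl fun b _ => harm b,
    ← lintegral_finsetSum (f := fun b ω => G b (Z ω, W ω)) _ fun b _ => (hG b).comp (hZ'.prodMk hW'),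
    ← lintegral_map (f := fun q => ∑ b, G b q) hsum (hZ'.prodMk hW'), hind,
    lintegral_prod _ hsum.aemeasurable, lintegral_map hsum.lintegral_prod_right' hZ']
  refine lintegral_congr fun ω => ?_
  rw [ModIGW.actionKernel, IsPolicy.lintegral_obsLaw (g := fun o => g (Y ω, o)) _ D
    (hg.comp measurable_prodMk_left)]
  simp only [G, Z, hcongr]

end Round

end ContextualBandit

namespace ContextualBandit

/-! ### The sample of an epoch -/

section Epoch

variable {𝒳 𝒜 Ω : Type*} [MeasurableSpace 𝒳] [MeasurableSpace 𝒜] [mΩ : MeasurableSpace Ω]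
  {x : ℕ → Ω → 𝒳} {r : ℕ → Ω → 𝒜 → unitInterval} {a : ℕ → Ω → 𝒜}
  [Fintype 𝒜] [DecidableEq 𝒜] [MeasurableSingletonClass 𝒜] [Nonempty 𝒜] {M : ℕ} [NeZero M]
  {alg : ModIGW 𝒳 𝒜 M} {D : Measure (𝒳 × (𝒜 → unitInterval))} {P : Measure Ω}
  [IsProbabilityMeasure D] [IsProbabilityMeasure P]

lemma ModIGW.measurable_lintegral_obsLaw_fst (alg : ModIGW 𝒳 𝒜 M) (m : ℕ)
    {β : Type*} [MeasurableSpace β] {g : ((ℕ → Obs 𝒳 𝒜) × β) × Obs 𝒳 𝒜 → ℝ≥0∞}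
    (hg : Measurable g) :
    Measurable fun q : (ℕ → Obs 𝒳 𝒜) × β =>
      ∫⁻ o, g (q, o) ∂obsLaw D (alg.actionKernel q.1 m) := by
  generalize hf : (fun q : ((ℕ → Obs 𝒳 𝒜) × β) × (ℕ → Obs 𝒳 𝒜) =>
      ∫⁻ o, g (q.1, o) ∂obsLaw D (alg.actionKernel q.2 m)) = f
  have h0 : Measurable f := by rw [← hf]; exact alg.measurable_lintegral_obsLaw (D := D) m hg
  have h1 : Measurable fun q : (ℕ → Obs 𝒳 𝒜) × β => (q, q.1) := measurable_id.prodMk measurable_fst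
  have h2 : (fun q : (ℕ → Obs 𝒳 𝒜) × β =>
      ∫⁻ o, g (q, o) ∂obsLaw D (alg.actionKernel q.1 m)) = fun q => f (q, q.1) := by
    rw [← hf]
  rw [h2]
  exact h0.comp h1

/-- Given the past, the observations of an epoch are i.i.d. -/
lemma IsRun.lintegral_sample (h : IsRun alg D P x r a) {m : ℕ} (hm : 1 ≤ m) (o : Obs 𝒳 𝒜) :
    ∀ (k : ℕ), k ≤ epochLength alg.τ₁ m →
      ∀ g : (ℕ → Obs 𝒳 𝒜) × (Fin k → Obs 𝒳 𝒜) → ℝ≥0∞, Measurable g →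
      ∫⁻ ω, g (truncate o (epochEnd alg.τ₁ (m - 1)) (observations x r a ω),
        fun j => observations x r a ω (epochEnd alg.τ₁ (m - 1) + 1 + j)) ∂P =
      ∫⁻ ω, ∫⁻ S, g (truncate o (epochEnd alg.τ₁ (m - 1)) (observations x r a ω), S)
        ∂Measure.pi (fun _ => obsLaw D (alg.actionKernel (observations x r a ω) m)) ∂P := by
  intro k
  induction k with
  | zero =>
    intro _ g hg
    refine lintegral_congr fun ω => ?_
    rw [Measure.pi_of_empty, lintegral_dirac]
    congr 2
    exact Subsingleton.elim _ _
  | succ k ih =>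
    intro hk g hg
    set N := epochEnd alg.τ₁ (m - 1) with hN
    have hend := epochEnd_pred_add_epochLength alg.τ₁ m
    -- The last observation is split off: the earlier ones belong to its past, so it can be
    -- integrated out first, and the induction hypothesis applies to the resulting function.
    let e := MeasurableEquiv.piFinSuccAbove (fun _ : Fin (k + 1) => Obs 𝒳 𝒜) (Fin.last k)
    have he : ∀ z : ℕ → Obs 𝒳 𝒜, (fun j : Fin (k + 1) => z (N + 1 + j)) =
        e.symm (z (N + 1 + k), fun j : Fin k => z (N + 1 + j)) := by
      intro z
      rw [MeasurableEquiv.eq_symm_apply]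
      refine Prod.ext ?_ ?_
      · simp [e, MeasurableEquiv.piFinSuccAbove]
      · funext j
        simp [e, MeasurableEquiv.piFinSuccAbove, Fin.init]
    let g' : ((ℕ → Obs 𝒳 𝒜) × (Fin k → Obs 𝒳 𝒜)) × Obs 𝒳 𝒜 → ℝ≥0∞ := fun q =>
      g (q.1.1, e.symm (q.2, q.1.2))
    have hg' : Measurable g' := hg.comp (measurable_fst.fst.prodMk
      (e.symm.measurable.comp (measurable_snd.prodMk measurable_fst.snd)))
    let Y : Ω → (ℕ → Obs 𝒳 𝒜) × (Fin k → Obs 𝒳 𝒜) := fun ω =>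
      (truncate o N (observations x r a ω), fun j => observations x r a ω (N + 1 + j))
    have hY : Measurable[past x r a (N + 1 + k)] Y := by
      refine (measurable_truncate_past o (by omega)).prodMk ?_
      exact @measurable_pi_lambda _ _ _ (past x r a (N + 1 + k)) _ _ fun j =>
        measurable_observations_past (by omega) (by omega)
    -- The kernel is a function of the truncated sequence, which is the first argument of `g`; this
    -- is why the induction is stated for functions of the pair.
    have hcongr : ∀ z, alg.actionKernel (truncate o N z) m = alg.actionKernel z m :=
      fun z => alg.actionKernel_congr (truncate_agrees o _ z)
    have hg'' : Measurable fun q : (ℕ → Obs 𝒳 𝒜) × (Fin k → Obs 𝒳 𝒜) =>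
        ∫⁻ y, g' (q, y) ∂obsLaw D (alg.actionKernel q.1 m) :=
      alg.measurable_lintegral_obsLaw_fst m hg'
    have hstep : ∫⁻ ω, g' (Y ω, observations x r a ω (N + 1 + k)) ∂P =
        ∫⁻ ω, ∫⁻ y, g' (Y ω, y) ∂obsLaw D (alg.actionKernel (observations x r a ω) m) ∂P :=
      h.lintegral_observation hm (by omega) (by omega) hY hg'
    have hih := ih (by omega) _ hg''
    simp only [hcongr] at hih
    have hleft : ∀ ω, g (truncate o N (observations x r a ω),
        fun j => observations x r a ω (N + 1 + j)) = g' (Y ω, observations x r a ω (N + 1 + k)) :=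
      fun ω => by rw [he]
    simp only [hleft]
    rw [hstep, hih]
    refine lintegral_congr fun ω => ?_
    set μ := obsLaw D (alg.actionKernel (observations x r a ω) m) with hμ
    have hmp := measurePreserving_piFinSuccAbove (fun _ : Fin (k + 1) => μ) (Fin.last k)
    have hgm : Measurable fun p : Obs 𝒳 𝒜 × (Fin k → Obs 𝒳 𝒜) =>
        g (truncate o N (observations x r a ω), e.symm p) :=
      hg.comp (measurable_const.prodMk e.symm.measurable)
    have h1 := hmp.lintegral_comp hgm
    rw [lintegral_prod_symm _ hgm.aemeasurable] at h1
    rw [← h1]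
    refine lintegral_congr fun S => ?_
    rw [show MeasurableEquiv.piFinSuccAbove (fun _ : Fin (k + 1) => Obs 𝒳 𝒜) (Fin.last k) = e
      from rfl, MeasurableEquiv.symm_apply_apply]

/-! ### Squared errors, and transfer of the i.i.d. guarantee to an epoch -/

lemma IsPolicy.sqDist_kernel {Q : 𝒳 → 𝒜 → ℝ} (hQ : IsPolicy Q) (f g : Model 𝒳 𝒜) :
    sqDist D hQ.kernel f g = ∫ x, ∑ b, Q x b * (f x b - g x b) ^ 2 ∂D.fst := by
  simp only [sqDist, hQ.integral_kernel]

lemma ModIGW.sqDist_actionKernel (alg : ModIGW 𝒳 𝒜 M) (z : ℕ → Obs 𝒳 𝒜) (m : ℕ)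
    (f g : Model 𝒳 𝒜) :
    sqDist D (alg.actionKernel z m) f g =
      ∫ x, ∑ b, alg.actionProb z m x b * (f x b - g x b) ^ 2 ∂D.fst :=
  (alg.isPolicy_actionProb z m).sqDist_kernel f g

lemma ModIGW.measurable_sqDist_fit (alg : ModIGW 𝒳 𝒜 M) (m n : ℕ) (i : Fin M)
    (fstar : Model 𝒳 𝒜) :
    Measurable fun q : (ℕ → Obs 𝒳 𝒜) × (Fin n → Obs 𝒳 𝒜) =>
      sqDist D (alg.actionKernel q.1 m) ((alg.est i).fit n q.2) fstar := by
  simp only [sqDist_actionKernel]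
  have h : Measurable fun p : ((ℕ → Obs 𝒳 𝒜) × (Fin n → Obs 𝒳 𝒜)) × 𝒳 =>
      ∑ b, alg.actionProb p.1.1 m p.2 b * ((alg.est i).fit n p.1.2 p.2 b - fstar p.2 b) ^ 2 := by
    refine Finset.measurable_sum _ fun b _ => Measurable.mul ?_ (Measurable.pow_const ?_ 2)
    · exact (alg.measurable_actionProb m b).comp (measurable_fst.fst.prodMk measurable_snd)
    · refine Measurable.sub ?_ ((fstar.measurable_apply b).comp measurable_snd)
      exact (measurable_subtype_coe.comp ((alg.est i).measurable_fit n b)).comp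
        (measurable_fst.snd.prodMk measurable_snd)
  exact (h.stronglyMeasurable.integral_prod_right' (ν := D.fst)).measurable

lemma prob_compl_le {Ω' : Type*} [MeasurableSpace Ω'] {μ : Measure Ω'} [IsProbabilityMeasure μ]
    {s : Set Ω'} (hs : MeasurableSet s) {ζ : ℝ} (h : ENNReal.ofReal (1 - ζ) ≤ μ s) :
    μ sᶜ ≤ ENNReal.ofReal ζ := by
  rw [prob_compl_eq_one_sub hs, tsub_le_iff_right, ← ENNReal.ofReal_one, ← add_sub_cancel ζ 1]
  exact ENNReal.ofReal_add_le.trans (by gcongr)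

/-- A guarantee for i.i.d. samples carries over to the sample of an epoch. -/
lemma IsRun.measure_lt_sqDist_fitted_le (h : IsRun alg D P x r a) (fstar : Model 𝒳 𝒜) {m : ℕ}
    (hm : 1 ≤ m) {ζ B : ℝ}
    (hB : ∀ z, ENNReal.ofReal (1 - ζ) ≤
      Measure.pi (fun _ : Fin (epochLength alg.τ₁ m) => obsLaw D (alg.actionKernel z m))
      {S | sqDist D (alg.actionKernel z m) ((alg.est ⊤).fit _ S) fstar ≤ B}) :
    P {ω | B < sqDist D (alg.actionKernel (observations x r a ω) m)
      (alg.fitted (observations x r a ω) (m + 1)) fstar} ≤ ENNReal.ofReal ζ := by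
  obtain ⟨⟨x₀, -⟩⟩ : Nonempty (𝒳 × (𝒜 → unitInterval)) := nonempty_of_isProbabilityMeasure D
  let o : Obs 𝒳 𝒜 := (x₀, Classical.arbitrary 𝒜, 0)
  have hcongr : ∀ z, alg.actionKernel (truncate o (epochEnd alg.τ₁ (m - 1)) z) m =
      alg.actionKernel z m := fun z => alg.actionKernel_congr (truncate_agrees o _ z)
  let A : Set ((ℕ → Obs 𝒳 𝒜) × (Fin (epochLength alg.τ₁ m) → Obs 𝒳 𝒜)) :=
    {q | B < sqDist D (alg.actionKernel q.1 m) ((alg.est ⊤).fit _ q.2) fstar}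
  have hA : MeasurableSet A :=
    measurableSet_lt measurable_const (alg.measurable_sqDist_fit (D := D) m _ ⊤ fstar)
  have hfit : ∀ z, alg.fitted z (m + 1) = (alg.est ⊤).fit _ (alg.sample z m) := by
    obtain ⟨k, rfl⟩ := Nat.exists_eq_add_of_le' hm
    exact fun z => rfl
  let Y : Ω → (ℕ → Obs 𝒳 𝒜) × (Fin (epochLength alg.τ₁ m) → Obs 𝒳 𝒜) := fun ω =>
    (truncate o (epochEnd alg.τ₁ (m - 1)) (observations x r a ω),
      alg.sample (observations x r a ω) m)
  have hY : Measurable Y :=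
    ((measurable_truncate_past o (Nat.lt_succ_self _)).mono (h.past_le _) le_rfl).prodMk
      ((alg.measurable_sample m).comp h.measurable_observations')
  have hset : {ω | B < sqDist D (alg.actionKernel (observations x r a ω) m)
      (alg.fitted (observations x r a ω) (m + 1)) fstar} = Y ⁻¹' A := by
    ext ω
    simp only [Set.mem_ofPred_eq, Set.mem_preimage, A, Y, hcongr, hfit]
  have key := h.lintegral_sample hm o _ le_rfl (A.indicator 1) (measurable_one.indicator hA)
  have hind : ∫⁻ ω, A.indicator 1 (Y ω) ∂P = P (Y ⁻¹' A) := by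
    rw [← lintegral_indicator_one (hY hA)]
    rfl
  rw [hset, ← hind]
  -- After conditioning, the inner integral is the failure probability on an i.i.d. sample from a
  -- fixed kernel, bounded by ζ for every past.
  refine (le_of_eq key).trans ((lintegral_mono (g := fun _ => ENNReal.ofReal ζ) fun ω => ?_).trans
    (by simp))
  have hpre : MeasurableSet {S | sqDist D (alg.actionKernel (observations x r a ω) m)
      ((alg.est ⊤).fit (epochLength alg.τ₁ m) S) fstar ≤ B} := by
    have h0 := alg.measurable_sqDist_fit (D := D) m (epochLength alg.τ₁ m) ⊤ fstar
    have h1 : Measurable fun S : Fin (epochLength alg.τ₁ m) → Obs 𝒳 𝒜 =>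
      (observations x r a ω, S) := measurable_prodMk_left
    exact measurableSet_le (Measurable.comp (f := fun S => (observations x r a ω, S)) h0 h1)
      measurable_const
  refine le_trans (le_of_eq ?_) (prob_compl_le hpre (hB (observations x r a ω)))
  rw [← lintegral_indicator_one hpre.compl]
  refine lintegral_congr fun S => ?_
  simp only [Set.indicator, A, hcongr, Set.mem_ofPred_eq, Set.mem_compl_iff, not_le, Pi.one_apply]

end Epoch

end ContextualBandit

namespace ContextualBandit

/-! ### Concentration of the regret -/

/-- The expected regret of a policy, if `f` is the mean reward. -/
def policyRegret {𝒳 𝒜 : Type*} [MeasurableSpace 𝒳] [MeasurableSpace 𝒜] [Fintype 𝒜]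
    (ν : Measure 𝒳) (best : ArgmaxRule 𝒜) (f : Model 𝒳 𝒜) (Q : 𝒳 → 𝒜 → ℝ) : ℝ :=
  ∫ x, ∑ a, Q x a * gap best f x a ∂ν

section Regret

variable {𝒳 𝒜 Ω : Type*} [MeasurableSpace 𝒳] [MeasurableSpace 𝒜] [mΩ : MeasurableSpace Ω]
  {x : ℕ → Ω → 𝒳} {r : ℕ → Ω → 𝒜 → unitInterval} {a : ℕ → Ω → 𝒜}
  [Fintype 𝒜] [DecidableEq 𝒜] [MeasurableSingletonClass 𝒜] [Nonempty 𝒜] {M : ℕ} [NeZero M]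
  {alg : ModIGW 𝒳 𝒜 M} {D : Measure (𝒳 × (𝒜 → unitInterval))} {P : Measure Ω}
  [IsProbabilityMeasure D] [IsProbabilityMeasure P]

lemma measurable_gap_obs (best : ArgmaxRule 𝒜) (f : Model 𝒳 𝒜) :
    Measurable fun o : Obs 𝒳 𝒜 => gap best f o.1 o.2.1 := by
  have h : Measurable fun q : 𝒳 × 𝒜 => gap best f q.1 q.2 :=
    measurable_from_prod_countable_left fun a => measurable_gap best f a
  exact h.comp (measurable_fst.prodMk measurable_snd.fst)

lemma IsPolicy.integral_obsLaw_gap {Q : 𝒳 → 𝒜 → ℝ} (hQ : IsPolicy Q) (best : ArgmaxRule 𝒜)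
    (f : Model 𝒳 𝒜) :
    ∫ o, gap best f o.1 o.2.1 ∂obsLaw D hQ.kernel = policyRegret D.fst best f Q := by
  have := hQ.isMarkovKernel
  have hm : Measurable fun q : (𝒳 × (𝒜 → unitInterval)) × 𝒜 => gap best f q.1.1 q.2 :=
    (measurable_gap_obs best f).comp IsPolicy.measurable_obs
  have hpol : Measurable fun y => ∑ a, Q y a * gap best f y a :=
    Finset.measurable_sum _ fun a _ => (hQ.measurable a).mul (measurable_gap best f a)
  rw [obsLaw, integral_map IsPolicy.measurable_obs.aemeasurable
    (measurable_gap_obs best f).aestronglyMeasurable, Measure.integral_compProd]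
  · simp only [Kernel.comap_apply, hQ.integral_kernel]
    rw [policyRegret, Measure.fst, integral_map measurable_fst.aemeasurable
      hpol.aestronglyMeasurable]
  · refine Integrable.of_bound hm.aestronglyMeasurable 1 (ae_of_all _ fun q => ?_)
    rw [Real.norm_of_nonneg (gap_nonneg _ _ _ _)]
    exact gap_le_one _ _ _ _

lemma ModIGW.measurable_policyRegret (alg : ModIGW 𝒳 𝒜 M) (f : Model 𝒳 𝒜) (m : ℕ) :
    Measurable fun z => policyRegret D.fst alg.best f (alg.actionProb z m) := by
  have h : Measurable fun p : (ℕ → Obs 𝒳 𝒜) × 𝒳 =>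
      ∑ b, alg.actionProb p.1 m p.2 b * gap alg.best f p.2 b :=
    Finset.measurable_sum _ fun b _ => (alg.measurable_actionProb m b).mul
      ((measurable_gap alg.best f b).comp measurable_snd)
  exact (h.stronglyMeasurable.integral_prod_right' (ν := D.fst)).measurable

lemma measurable_policyRegret_past (o : Obs 𝒳 𝒜) (f : Model 𝒳 𝒜) {m t : ℕ}
    (ht : epochEnd alg.τ₁ (m - 1) < t) :
    Measurable[past x r a t] fun ω =>
      policyRegret D.fst alg.best f (alg.actionProb (observations x r a ω) m) := by
  have hcongr : ∀ z, alg.actionProb (truncate o (epochEnd alg.τ₁ (m - 1)) z) m =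
      alg.actionProb z m := fun z => alg.actionProb_congr (truncate_agrees o _ z)
  have h := (alg.measurable_policyRegret (D := D) f m).comp
    (measurable_truncate_past (x := x) (r := r) (a := a) o ht)
  simpa only [Function.comp_def, hcongr] using h

/-- The deviation of the regret from the sum of its conditional expectations. -/
def regretDeviation (alg : ModIGW 𝒳 𝒜 M) (D : Measure (𝒳 × (𝒜 → unitInterval)))
    (f : Model 𝒳 𝒜) (epoch : ℕ → ℕ) (z : ℕ → Obs 𝒳 𝒜) (t : ℕ) : ℝ :=
  ∑ s ∈ Finset.Icc 1 t, (gap alg.best f (z s).1 (z s).2.1 -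
    policyRegret D.fst alg.best f (alg.actionProb z (epoch s)))

lemma measurable_regretDeviation_past (f : Model 𝒳 𝒜) {epoch : ℕ → ℕ}
    (hepoch : ∀ s, 1 ≤ s → 1 ≤ epoch s ∧ epochEnd alg.τ₁ (epoch s - 1) < s ∧
      s ≤ epochEnd alg.τ₁ (epoch s)) {t T : ℕ} (h : t < T) :
    Measurable[past x r a T] fun ω =>
      regretDeviation alg D f epoch (observations x r a ω) t := by
  obtain ⟨⟨x₀, -⟩⟩ : Nonempty (𝒳 × (𝒜 → unitInterval)) := nonempty_of_isProbabilityMeasure D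
  refine Finset.measurable_sum _ fun s hs => ?_
  obtain ⟨hs1, hs2⟩ := Finset.mem_Icc.1 hs
  refine Measurable.sub ?_ (measurable_policyRegret_past (x₀, Classical.arbitrary 𝒜, 0) f
    ((hepoch s hs1).2.1.trans_le (by omega)))
  exact (measurable_gap_obs alg.best f).comp (measurable_observations_past hs1 (by omega))

/-- Hoeffding's lemma: the gap lies in [0,1], so it is sub-Gaussian around its mean with variance
proxy 1/4. -/
lemma lintegral_exp_gap_le (z : ℕ → Obs 𝒳 𝒜) (m : ℕ) (f : Model 𝒳 𝒜) (c : ℝ) :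
    ∫⁻ o, ENNReal.ofReal (Real.exp (c * (gap alg.best f o.1 o.2.1 -
      policyRegret D.fst alg.best f (alg.actionProb z m)))) ∂obsLaw D (alg.actionKernel z m) ≤
      ENNReal.ofReal (Real.exp (c ^ 2 / 8)) := by
  have h := hasSubgaussianMGF_of_mem_Icc (μ := obsLaw D (alg.actionKernel z m)) (a := 0) (b := 1)
    (measurable_gap_obs alg.best f).aemeasurable
    (ae_of_all _ fun o => ⟨gap_nonneg _ _ _ _, gap_le_one _ _ _ _⟩)
  have hint : ∫ o, gap alg.best f o.1 o.2.1 ∂obsLaw D (alg.actionKernel z m) =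
      policyRegret D.fst alg.best f (alg.actionProb z m) :=
    (alg.isPolicy_actionProb z m).integral_obsLaw_gap alg.best f
  rw [hint] at h
  rw [← ofReal_integral_eq_lintegral_ofReal (h.integrable_exp_mul c)
    (ae_of_all _ fun o => (Real.exp_pos _).le)]
  refine ENNReal.ofReal_le_ofReal ((h.mgf_le c).trans (Real.exp_le_exp.2 (le_of_eq ?_)))
  simp
  ring

/-- The earlier deviation and the conditional mean of the new gap are past-measurable, so the newest
increment is integrated out first and contributes a factor exp(c²/8). -/
lemma IsRun.lintegral_exp_regretDeviation_le (h : IsRun alg D P x r a) (f : Model 𝒳 𝒜)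
    {epoch : ℕ → ℕ} (hepoch : ∀ s, 1 ≤ s → 1 ≤ epoch s ∧ epochEnd alg.τ₁ (epoch s - 1) < s ∧
      s ≤ epochEnd alg.τ₁ (epoch s)) (c : ℝ) (t : ℕ) :
    ∫⁻ ω, ENNReal.ofReal (Real.exp
      (c * regretDeviation alg D f epoch (observations x r a ω) t)) ∂P ≤
      ENNReal.ofReal (Real.exp (c ^ 2 / 8 * t)) := by
  obtain ⟨⟨x₀, -⟩⟩ : Nonempty (𝒳 × (𝒜 → unitInterval)) := nonempty_of_isProbabilityMeasure D
  induction t with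
  | zero => simp [regretDeviation]
  | succ t ih =>
    obtain ⟨h1, h2, h3⟩ := hepoch (t + 1) (by omega)
    let Y : Ω → ℝ × ℝ := fun ω => (regretDeviation alg D f epoch (observations x r a ω) t,
      policyRegret D.fst alg.best f (alg.actionProb (observations x r a ω) (epoch (t + 1))))
    have hY : Measurable[past x r a (t + 1)] Y :=
      (measurable_regretDeviation_past f hepoch (Nat.lt_succ_self t)).prodMk
        (measurable_policyRegret_past (x₀, Classical.arbitrary 𝒜, 0) f h2)
    let g : (ℝ × ℝ) × Obs 𝒳 𝒜 → ℝ≥0∞ := fun q => ENNReal.ofReal (Real.exp (c * q.1.1)) *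
      ENNReal.ofReal (Real.exp (c * (gap alg.best f q.2.1 q.2.2.1 - q.1.2)))
    have hg : Measurable g := by
      have hgap : Measurable fun q : (ℝ × ℝ) × Obs 𝒳 𝒜 => gap alg.best f q.2.1 q.2.2.1 :=
        (measurable_gap_obs alg.best f).comp measurable_snd
      have h11 : Measurable fun q : (ℝ × ℝ) × Obs 𝒳 𝒜 => q.1.1 := measurable_fst.fst
      have h12 : Measurable fun q : (ℝ × ℝ) × Obs 𝒳 𝒜 => q.1.2 := measurable_fst.snd
      exact (h11.const_mul c).exp.ennreal_ofReal.mul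
        ((hgap.sub h12).const_mul c).exp.ennreal_ofReal
    have hsplit : ∀ ω, ENNReal.ofReal (Real.exp
        (c * regretDeviation alg D f epoch (observations x r a ω) (t + 1))) =
        g (Y ω, observations x r a ω (t + 1)) := by
      intro ω
      simp only [g, Y, ← ENNReal.ofReal_mul (Real.exp_pos _).le, ← Real.exp_add, ← mul_add]
      congr 3
      exact Finset.sum_Icc_succ_top (by omega) _
    simp only [hsplit]
    rw [h.lintegral_observation h1 h2 h3 hY hg]
    calc _ ≤ ∫⁻ ω, ENNReal.ofReal (Real.exp
          (c * regretDeviation alg D f epoch (observations x r a ω) t)) *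
          ENNReal.ofReal (Real.exp (c ^ 2 / 8)) ∂P := by
          refine lintegral_mono fun ω => ?_
          simp only [g, Y]
          rw [lintegral_const_mul' _ _ ENNReal.ofReal_ne_top]
          gcongr
          exact lintegral_exp_gap_le _ _ _ _
      _ ≤ ENNReal.ofReal (Real.exp (c ^ 2 / 8 * t)) * ENNReal.ofReal (Real.exp (c ^ 2 / 8)) := by
          rw [lintegral_mul_const' _ _ ENNReal.ofReal_ne_top]
          gcongr
      _ = _ := by
          rw [← ENNReal.ofReal_mul (Real.exp_pos _).le, ← Real.exp_add]
          congr 2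
          push_cast
          ring

/-- An Azuma–Hoeffding bound for the regret. -/
lemma IsRun.measure_le_regretDeviation_le (h : IsRun alg D P x r a) (f : Model 𝒳 𝒜)
    {epoch : ℕ → ℕ} (hepoch : ∀ s, 1 ≤ s → 1 ≤ epoch s ∧ epochEnd alg.τ₁ (epoch s - 1) < s ∧
      s ≤ epochEnd alg.τ₁ (epoch s)) {t : ℕ} (ht : 1 ≤ t) {η : ℝ} (h0 : 0 < η) (h1 : η ≤ 1) :
    P {ω | Real.sqrt (t * Real.log (1 / η) / 2) ≤
      regretDeviation alg D f epoch (observations x r a ω) t} ≤ ENNReal.ofReal η := by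
  have ht0 : (0 : ℝ) < t := by exact_mod_cast ht
  have hlog : 0 ≤ Real.log (1 / η) := Real.log_nonneg ((one_le_div h0).2 h1)
  set u := Real.sqrt (t * Real.log (1 / η) / 2) with hu
  have hu0 : 0 ≤ u := Real.sqrt_nonneg _
  have hu2 : u ^ 2 = t * Real.log (1 / η) / 2 := Real.sq_sqrt (by positivity)
  have hm : Measurable fun ω => ENNReal.ofReal (Real.exp
      (4 * u / t * regretDeviation alg D f epoch (observations x r a ω) t)) :=
    (((measurable_regretDeviation_past f hepoch (Nat.lt_succ_self t)).mono
      (h.past_le _) le_rfl).const_mul _).exp.ennreal_ofReal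
  -- Chernoff's bound: c = 4u/t minimizes c²t/8 - cu, with minimum -2u²/t, and `u` is chosen so that
  -- this equals log η.
  calc _ ≤ P {ω | ENNReal.ofReal (Real.exp (4 * u / t * u)) ≤ ENNReal.ofReal (Real.exp
          (4 * u / t * regretDeviation alg D f epoch (observations x r a ω) t))} := by
        refine measure_mono fun ω hω => ?_
        refine ENNReal.ofReal_le_ofReal (Real.exp_le_exp.2 ?_)
        exact mul_le_mul_of_nonneg_left hω (by positivity)
    _ ≤ _ := meas_ge_le_lintegral_div hm.aemeasurable
        (by simpa using Real.exp_pos _) ENNReal.ofReal_ne_top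
    _ ≤ ENNReal.ofReal (Real.exp ((4 * u / t) ^ 2 / 8 * t)) /
        ENNReal.ofReal (Real.exp (4 * u / t * u)) := by
        gcongr
        exact h.lintegral_exp_regretDeviation_le f hepoch _ t
    _ = ENNReal.ofReal η := by
        rw [← ENNReal.ofReal_div_of_pos (Real.exp_pos _), ← Real.exp_sub]
        congr 1
        rw [show (4 * u / t) ^ 2 / 8 * t - 4 * u / t * u = - (2 * u ^ 2 / t) by field_simp; ring,
          hu2, one_div, Real.log_inv,
          show -(2 * (t * -Real.log η / 2) / t) = Real.log η by field_simp, Real.exp_log h0]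

end Regret

end ContextualBandit

namespace ContextualBandit

/-! ### Regret under an estimated model -/

section Policy

variable {𝒳 𝒜 : Type*} [MeasurableSpace 𝒳] [MeasurableSpace 𝒜] [Fintype 𝒜]
  [MeasurableSingletonClass 𝒜] {ν : Measure 𝒳} [IsProbabilityMeasure ν]
  {Q : 𝒳 → 𝒜 → ℝ}

lemma IsPolicy.sum_mul_mem_Icc (hQ : IsPolicy Q) {g : 𝒜 → ℝ} (h0 : ∀ a, 0 ≤ g a)
    (h1 : ∀ a, g a ≤ 1) (x : 𝒳) : ∑ a, Q x a * g a ∈ Set.Icc (0 : ℝ) 1 := by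
  refine ⟨Finset.sum_nonneg fun a _ => mul_nonneg (hQ.nonneg x a) (h0 a), ?_⟩
  rw [← hQ.sum_eq_one x]
  exact Finset.sum_le_sum fun a _ => mul_le_of_le_one_right (hQ.nonneg x a) (h1 a)

lemma IsPolicy.integrable_sum_mul (hQ : IsPolicy Q) {g : 𝒳 → 𝒜 → ℝ}
    (hg : ∀ a, Measurable fun x => g x a) (h0 : ∀ x a, 0 ≤ g x a) (h1 : ∀ x a, g x a ≤ 1) :
    Integrable (fun x => ∑ a, Q x a * g x a) ν := by
  refine Integrable.of_bound (Finset.measurable_sum _ fun a _ =>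
    (hQ.measurable a).mul (hg a)).aestronglyMeasurable 1 (ae_of_all _ fun x => ?_)
  have h := hQ.sum_mul_mem_Icc (h0 x) (h1 x) x
  rw [Real.norm_of_nonneg h.1]
  exact h.2

lemma IsPolicy.le_one (hQ : IsPolicy Q) (x : 𝒳) (a : 𝒜) : Q x a ≤ 1 := by
  rw [← hQ.sum_eq_one x]
  exact Finset.single_le_sum (fun b _ => hQ.nonneg x b) (Finset.mem_univ a)

lemma IsPolicy.integrable_gap (hQ : IsPolicy Q) (best : ArgmaxRule 𝒜) (f : Model 𝒳 𝒜) :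
    Integrable (fun x => ∑ a, Q x a * gap best f x a) ν :=
  hQ.integrable_sum_mul (measurable_gap best f) (gap_nonneg best f) (gap_le_one best f)

lemma IsPolicy.integrable_abs_sub (hQ : IsPolicy Q) (f g : Model 𝒳 𝒜) :
    Integrable (fun x => ∑ a, Q x a * |f x a - g x a|) ν :=
  hQ.integrable_sum_mul (fun a => ((f.measurable_apply a).sub (g.measurable_apply a)).abs)
    (fun _ _ => abs_nonneg _) (f.abs_sub_le_one g)

lemma IsPolicy.integrable_sq_sub (hQ : IsPolicy Q) (f g : Model 𝒳 𝒜) :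
    Integrable (fun x => ∑ a, Q x a * (f x a - g x a) ^ 2) ν :=
  hQ.integrable_sum_mul (fun a => ((f.measurable_apply a).sub (g.measurable_apply a)).pow_const 2)
    (fun _ _ => sq_nonneg _) fun x a => by
      rw [← sq_abs]; exact pow_le_one₀ (abs_nonneg _) (f.abs_sub_le_one g x a)

lemma IsPolicy.policyRegret_mem_Icc (hQ : IsPolicy Q) (best : ArgmaxRule 𝒜) (f : Model 𝒳 𝒜) :
    policyRegret ν best f Q ∈ Set.Icc (0 : ℝ) 1 := by
  have h x := hQ.sum_mul_mem_Icc (gap_nonneg best f x) (gap_le_one best f x) x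
  refine ⟨integral_nonneg fun x => (h x).1, ?_⟩
  calc _ ≤ ∫ _, (1 : ℝ) ∂ν :=
        integral_mono (hQ.integrable_gap best f) (integrable_const _) fun x => (h x).2
    _ = 1 := by simp

/-- Expanding (θ - p|e|)² ≥ 0 gives 2θp|e| ≤ θ² + p²e²; bound θ² by θ²pw and divide by p, which
cannot vanish. -/
lemma abs_le_of_one_le_mul {p w θ e : ℝ} (hp : 0 ≤ p) (hθ : 0 < θ) (h : 1 ≤ p * w) :
    |e| ≤ θ / 2 * w + 1 / (2 * θ) * (p * e ^ 2) := by
  have hp' : 0 < p := hp.lt_of_ne fun h0 => by rw [← h0, zero_mul] at h; linarith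
  have key : 2 * θ * |e| ≤ θ ^ 2 * w + p * e ^ 2 := by
    refine le_of_mul_le_mul_left ?_ hp'
    have h1 := mul_le_mul_of_nonneg_left h (sq_nonneg θ)
    have h2 := sq_nonneg (θ - p * |e|)
    rw [← sq_abs e]
    nlinarith
  have h3 : θ / 2 * w + 1 / (2 * θ) * (p * e ^ 2) = (θ ^ 2 * w + p * e ^ 2) / (2 * θ) := by
    field_simp
  rw [h3, le_div_iff₀ (by positivity)]
  linarith

/-- The difference of two models under a policy `Q`, in terms of their squared distance under a
policy `p` that explores the arms with a small gap. -/
lemma IsPolicy.integral_abs_sub_le (hQ : IsPolicy Q) {p : 𝒳 → 𝒜 → ℝ} (hp : IsPolicy p)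
    (best : ArgmaxRule 𝒜) (f g h : Model 𝒳 𝒜) {K γ θ : ℝ} (hθ : 0 < θ)
    (hw : ∀ x a, 1 ≤ p x a * (K + γ * gap best h x a)) :
    ∫ x, ∑ a, Q x a * |f x a - g x a| ∂ν ≤ θ / 2 * (K + γ * policyRegret ν best h Q) +
      1 / (2 * θ) * ∫ x, ∑ a, p x a * (f x a - g x a) ^ 2 ∂ν := by
  have h1 := hQ.integrable_gap (ν := ν) best h
  have h2 := hp.integrable_sq_sub (ν := ν) f g
  have hleft : Integrable (fun x => θ / 2 * (K + γ * ∑ a, Q x a * gap best h x a)) ν :=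
    ((integrable_const K).add (h1.const_mul γ)).const_mul _
  have hright : θ / 2 * (K + γ * policyRegret ν best h Q) +
      1 / (2 * θ) * ∫ x, ∑ a, p x a * (f x a - g x a) ^ 2 ∂ν =
      ∫ x, (θ / 2 * (K + γ * ∑ a, Q x a * gap best h x a) +
        1 / (2 * θ) * ∑ a, p x a * (f x a - g x a) ^ 2) ∂ν := by
    rw [integral_add hleft (h2.const_mul _), integral_const_mul, integral_const_mul,
      integral_add (integrable_const K) (h1.const_mul γ), integral_const_mul]
    simp [policyRegret]
  rw [hright]
  refine integral_mono (hQ.integrable_abs_sub f g)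
    (hleft.add (h2.const_mul _)) fun x => ?_
  have h3 : θ / 2 * (K + γ * ∑ a, Q x a * gap best h x a) +
      1 / (2 * θ) * ∑ a, p x a * (f x a - g x a) ^ 2 =
      ∑ a, (Q x a * (θ / 2 * (K + γ * gap best h x a)) +
        1 / (2 * θ) * (p x a * (f x a - g x a) ^ 2)) := by
    have h4 : K = ∑ a, Q x a * K := by rw [← Finset.sum_mul, hQ.sum_eq_one, one_mul]
    conv_lhs => rw [h4]
    simp only [Finset.mul_sum, mul_add, Finset.sum_add_distrib]
    congr 2
    · exact Finset.sum_congr rfl fun a _ => by ring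
    · exact Finset.sum_congr rfl fun a _ => by ring
  change ∑ a, Q x a * |f x a - g x a| ≤ θ / 2 * (K + γ * ∑ a, Q x a * gap best h x a) +
      1 / (2 * θ) * ∑ a, p x a * (f x a - g x a) ^ 2
  rw [h3]
  refine Finset.sum_le_sum fun a _ => ?_
  have h5 := abs_le_of_one_le_mul (e := f x a - g x a) (hp.nonneg x a) hθ (hw x a)
  have h6 : 0 ≤ 1 / (2 * θ) * (p x a * (f x a - g x a) ^ 2) := by
    have := hp.nonneg x a
    positivity
  calc _ ≤ Q x a * (θ / 2 * (K + γ * gap best h x a) +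
        1 / (2 * θ) * (p x a * (f x a - g x a) ^ 2)) :=
        mul_le_mul_of_nonneg_left h5 (hQ.nonneg x a)
    -- The weight of `Q` is dropped from the squared error, as it is at most 1; what remains is the
    -- error under `p`, the only one the oracle controls.
    _ ≤ _ := by
        rw [mul_add]
        exact add_le_add_right (mul_le_of_le_one_left h6 (hQ.le_one x a)) _

/-! ### Greedy policies and the comparison of regrets under two models -/

variable [DecidableEq 𝒜]

/-- The policy that selects the arm of largest value under `f`. -/
def greedy (best : ArgmaxRule 𝒜) (f : Model 𝒳 𝒜) (x : 𝒳) (a : 𝒜) : ℝ :=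
  if a = best.pick (f x) then 1 else 0

lemma sum_greedy_mul (best : ArgmaxRule 𝒜) (f : Model 𝒳 𝒜) (x : 𝒳) (g : 𝒜 → ℝ) :
    ∑ a, greedy best f x a * g a = g (best.pick (f x)) := by
  simp [greedy]

lemma isPolicy_greedy (best : ArgmaxRule 𝒜) (f : Model 𝒳 𝒜) : IsPolicy (greedy best f) where
  measurable a := Measurable.ite (measurableSet_eq_fun measurable_const
    (measurable_pick_model best f)) measurable_const measurable_const
  nonneg x a := by unfold greedy; split_ifs <;> norm_num
  sum_eq_one x := by simpa using sum_greedy_mul best f x fun _ => 1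

lemma policyRegret_greedy (best : ArgmaxRule 𝒜) (f : Model 𝒳 𝒜) :
    policyRegret ν best f (greedy best f) = 0 := by
  simp [policyRegret, sum_greedy_mul, gap]

/-- The best value of `g` is at least the value of `g` at the best arm of `f`. So the difference of
gaps is at most the model error at the played arm plus that at the greedy arm of `f`. -/
lemma IsPolicy.policyRegret_sub_le (hQ : IsPolicy Q) (best : ArgmaxRule 𝒜) (f g : Model 𝒳 𝒜) :
    policyRegret ν best f Q - policyRegret ν best g Q ≤
      ∫ x, ∑ a, Q x a * |f x a - g x a| ∂ν +
      ∫ x, ∑ a, greedy best f x a * |f x a - g x a| ∂ν := by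
  rw [policyRegret, policyRegret, ← integral_sub (hQ.integrable_gap best f)
    (hQ.integrable_gap best g), ← integral_add (hQ.integrable_abs_sub f g)
    ((isPolicy_greedy best f).integrable_abs_sub f g)]
  refine integral_mono ((hQ.integrable_gap best f).sub (hQ.integrable_gap best g))
    ((hQ.integrable_abs_sub f g).add ((isPolicy_greedy best f).integrable_abs_sub f g)) fun x => ?_
  change ∑ a, Q x a * gap best f x a - ∑ a, Q x a * gap best g x a ≤
    ∑ a, Q x a * |f x a - g x a| + ∑ a, greedy best f x a * |f x a - g x a|
  rw [sum_greedy_mul best f x fun a => |f x a - g x a|, ← Finset.sum_sub_distrib]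
  set e := |f x (best.pick (f x)) - g x (best.pick (f x))| with he
  have h1 : e = ∑ a, Q x a * e := by rw [← Finset.sum_mul, hQ.sum_eq_one, one_mul]
  conv_rhs => rw [h1]
  rw [← Finset.sum_add_distrib]
  refine Finset.sum_le_sum fun a _ => ?_
  rw [← mul_sub, ← mul_add]
  refine mul_le_mul_of_nonneg_left ?_ (hQ.nonneg x a)
  have h2 := best.le_pick (g x) (best.pick (f x))
  have h3 := le_abs_self (f x (best.pick (f x)) - g x (best.pick (f x)))
  have h4 := neg_abs_le (f x a - g x a)
  unfold gap
  linarith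

/-- One step of the induction over epochs: an accurate model `f'`, fitted under the policy `p` of
the model `h`, yields the regret of every policy up to constants. -/
lemma policyRegret_le_of_estimate {p : 𝒳 → 𝒜 → ℝ} (hp : IsPolicy p) (best : ArgmaxRule 𝒜)
    (fstar f' h : Model 𝒳 𝒜) {K γ θ c E A : ℝ} (hθ : 0 < θ) (hγ : 0 ≤ γ) (hθγ : θ * γ ≤ 1 / 4)
    (hw : ∀ x a, 1 ≤ p x a * (K + γ * gap best h x a))
    (hh : ∀ Q : 𝒳 → 𝒜 → ℝ, IsPolicy Q →
      policyRegret ν best h Q ≤ 2 * policyRegret ν best fstar Q + c)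
    (hE : ∫ x, ∑ a, p x a * (f' x a - fstar x a) ^ 2 ∂ν ≤ E)
    (hA : θ * (K + γ * c) + E / θ ≤ A) (hQ : IsPolicy Q) :
    policyRegret ν best fstar Q ≤ 4 / 3 * (policyRegret ν best f' Q + A) ∧
      policyRegret ν best f' Q ≤ 5 / 4 * policyRegret ν best fstar Q + 4 / 3 * A := by
  -- Replacing the regret under `h` by twice the true regret plus `c` gives the coefficient θγ ≤ 1/4
  -- for the true regret; the remaining terms are half of the left side of `hA`.
  have key : ∀ R : 𝒳 → 𝒜 → ℝ, IsPolicy R → ∫ x, ∑ a, R x a * |f' x a - fstar x a| ∂ν ≤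
      A / 2 + policyRegret ν best fstar R / 4 := by
    intro R hR
    have h1 := hR.integral_abs_sub_le (ν := ν) hp best f' fstar h hθ hw
    have h2 := mul_le_mul_of_nonneg_left (hh R hR) hγ
    have h3 := (hR.policyRegret_mem_Icc (ν := ν) best fstar).1
    have h4 : 1 / (2 * θ) * ∫ x, ∑ a, p x a * (f' x a - fstar x a) ^ 2 ∂ν ≤ E / θ / 2 := by
      rw [div_div, mul_comm θ 2, one_div_mul_eq_div]
      gcongr
    have h5 : θ / 2 * (K + γ * policyRegret ν best h R) ≤
        θ / 2 * (K + γ * (2 * policyRegret ν best fstar R + c)) := by gcongr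
    have h6 := mul_le_mul_of_nonneg_right hθγ h3
    nlinarith
  have hswap : ∀ R : 𝒳 → 𝒜 → ℝ, ∫ x, ∑ a, R x a * |fstar x a - f' x a| ∂ν =
      ∫ x, ∑ a, R x a * |f' x a - fstar x a| ∂ν := fun R => by simp only [abs_sub_comm]
  -- The greedy policy of `fstar` has no true regret, so only `R` contributes a quarter of its
  -- regret, which is absorbed on the left; hence 4/3.
  have upper : ∀ R : 𝒳 → 𝒜 → ℝ, IsPolicy R → policyRegret ν best fstar R ≤
      4 / 3 * (policyRegret ν best f' R + A) := by
    intro R hR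
    have h1 := hR.policyRegret_sub_le (ν := ν) best fstar f'
    have h2 := key _ hR
    have h3 := key _ (isPolicy_greedy best fstar)
    rw [policyRegret_greedy] at h3
    rw [hswap, hswap] at h1
    linarith
  refine ⟨upper Q hQ, ?_⟩
  -- In this direction the greedy policy of `f'` appears. Its regret under `f'` is zero, so `upper`
  -- bounds its true regret by 4A/3, a quarter of which gives A + A/3 = 4A/3.
  have h1 := hQ.policyRegret_sub_le (ν := ν) best f' fstar
  have h2 := key _ hQ
  have h3 := key _ (isPolicy_greedy best f')
  have h4 := upper _ (isPolicy_greedy best f')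
  rw [policyRegret_greedy] at h4
  linarith

end Policy

/-! ### Regret of the epochs -/

namespace ModIGW

variable {𝒳 𝒜 : Type*} [MeasurableSpace 𝒳] [MeasurableSpace 𝒜] {M : ℕ} (alg : ModIGW 𝒳 𝒜 M)

/-- The estimation rate of epoch `m` for a class of complexity one. -/
def unitRate (m : ℕ) : ℝ := rate alg.C₁ 1 (epochLength alg.τ₁ m) (alg.conf m)

lemma ξ_eq_mul_unitRate (i : Fin M) (m : ℕ) :
    alg.ξ i (epochLength alg.τ₁ m) (alg.conf m) = alg.d i * alg.unitRate m := by
  simp only [ξ, unitRate, rate, Nat.cast_one]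
  ring

variable [Fintype 𝒜] [DecidableEq 𝒜] [Nonempty 𝒜] [MeasurableSingletonClass 𝒜] [NeZero M]

/-- The scale of the expected regret of epoch `m + 1`. -/
def regretScale (m : ℕ) : ℝ := Real.sqrt (Fintype.card 𝒜 * alg.unitRate m)

variable {alg}

/-- The rate cancels between the two factors, leaving only the dimension of the selected class. Both
the upper and the lower bound on γ are read off from this identity. -/
lemma gamma_sq_mul_regretScale_sq (hunit : ∀ m, 1 ≤ m → 0 < alg.unitRate m)
    (hd : ∀ i, 1 ≤ alg.d i) (z : ℕ → Obs 𝒳 𝒜) {m : ℕ} (hm : 1 ≤ m) :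
    (alg.gamma z (m + 1) * alg.regretScale m) ^ 2 * (8 * alg.d (alg.index z (m + 1))) =
      (Fintype.card 𝒜 : ℝ) ^ 2 := by
  obtain ⟨k, rfl⟩ := Nat.exists_eq_add_of_le' hm
  have h1 := hunit (k + 1) hm
  have h2 : (1 : ℝ) ≤ alg.d (alg.index z (k + 2)) := by exact_mod_cast hd _
  have h3 : alg.gamma z (k + 1 + 1) = Real.sqrt (Fintype.card 𝒜 /
      (8 * (alg.d (alg.index z (k + 2)) * alg.unitRate (k + 1)))) := by
    rw [← ξ_eq_mul_unitRate]; rfl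
  rw [h3, regretScale, mul_pow, Real.sq_sqrt (by positivity), Real.sq_sqrt (by positivity)]
  field_simp

lemma gamma_mul_regretScale_le (hunit : ∀ m, 1 ≤ m → 0 < alg.unitRate m)
    (hd : ∀ i, 1 ≤ alg.d i) (z : ℕ → Obs 𝒳 𝒜) {m : ℕ} (hm : 1 ≤ m) :
    (alg.gamma z (m + 1) * alg.regretScale m) ^ 2 ≤ (Fintype.card 𝒜 : ℝ) ^ 2 / 8 := by
  have h2 : (1 : ℝ) ≤ alg.d (alg.index z (m + 1)) := by exact_mod_cast hd _
  have h := gamma_sq_mul_regretScale_sq hunit hd z hm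
  nlinarith [sq_nonneg (alg.gamma z (m + 1) * alg.regretScale m)]

variable {ν : Measure 𝒳} [IsProbabilityMeasure ν] {fstar : Model 𝒳 𝒜} {z : ℕ → Obs 𝒳 𝒜}
  {d : ℝ}

/-- In every epoch after the first one, the regret under the fitted model and the true regret of a
policy are comparable. -/
lemma policyRegret_comparable (hd1 : 1 ≤ d) (hunit : ∀ m, 1 ≤ m → 0 < alg.unitRate m)
    (hunit2 : ∀ m, 1 ≤ m → alg.unitRate (m + 1) ≤ 2 * alg.unitRate m)
    (hd : ∀ i, 1 ≤ alg.d i)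
    (hest : ∀ m, 1 ≤ m → ∫ x, ∑ a, alg.actionProb z m x a *
      (alg.fitted z (m + 1) x a - fstar x a) ^ 2 ∂ν ≤ d * alg.unitRate m)
    {m : ℕ} (hm : 1 ≤ m) : ∀ Q : 𝒳 → 𝒜 → ℝ, IsPolicy Q →
      policyRegret ν alg.best fstar Q ≤
        2 * policyRegret ν alg.best (alg.fitted z (m + 1)) Q + 5 * d * alg.regretScale m ∧
      policyRegret ν alg.best (alg.fitted z (m + 1)) Q ≤
        2 * policyRegret ν alg.best fstar Q + 5 * d * alg.regretScale m := by
  have hK : (0 : ℝ) < Fintype.card 𝒜 := by exact_mod_cast Fintype.card_pos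
  have hs : ∀ m, 1 ≤ m → 0 < alg.regretScale m := fun m hm =>
    Real.sqrt_pos.2 (mul_pos hK (hunit m hm))
  have hs2 : ∀ m, 1 ≤ m → alg.regretScale m ^ 2 = Fintype.card 𝒜 * alg.unitRate m := fun m hm =>
    Real.sq_sqrt (mul_pos hK (hunit m hm)).le
  -- The parameter θ is taken to be s_m/(2K) throughout; this computes the term E/θ for E = d u_m.
  have hE : ∀ m, 1 ≤ m → d * alg.unitRate m / (alg.regretScale m / (2 * Fintype.card 𝒜)) =
      2 * d * alg.regretScale m := by
    intro m hm
    have h1 := (hs m hm).ne'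
    field_simp
    rw [hs2 m hm, mul_comm]
  induction m, hm using Nat.le_induction with
  | base =>
    intro Q hQ
    have h0 : ∀ x a, gap alg.best (alg.fitted z 1) x a = 0 := fun x a => sub_self _
    -- The initial model is zero, so all its gaps vanish and the exploration bound holds with γ = 0
    -- and no regret from an earlier model.
    have hw : ∀ x a, 1 ≤ alg.actionProb z 1 x a *
        (Fintype.card 𝒜 + 0 * gap alg.best (alg.fitted z 1) x a) := by
      intro x a
      have h := alg.one_le_actionProb_mul z 1 x a
      rwa [h0, mul_zero] at h ⊢
    obtain ⟨h1, h2⟩ := policyRegret_le_of_estimate (alg.isPolicy_actionProb z 1) alg.best fstar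
      (alg.fitted z 2) (alg.fitted z 1) (c := 0) (A := 3 * d * alg.regretScale 1)
      (div_pos (hs 1 le_rfl) (mul_pos two_pos hK)) le_rfl (by norm_num) hw
      (fun R hR => by
        have h3 := (hR.policyRegret_mem_Icc (ν := ν) alg.best fstar).1
        simp only [policyRegret, h0, mul_zero, Finset.sum_const_zero, integral_zero]
        simp only [policyRegret] at h3
        linarith) (hest 1 le_rfl) (by
        rw [hE 1 le_rfl]
        have h4 : alg.regretScale 1 / (2 * Fintype.card 𝒜) * (Fintype.card 𝒜 + 0 * 0) =
          alg.regretScale 1 / 2 := by field_simp; ring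
        rw [h4]
        nlinarith [hs 1 le_rfl]) hQ
    have h5 := (hQ.policyRegret_mem_Icc (ν := ν) alg.best fstar).1
    have h6 := (hQ.policyRegret_mem_Icc (ν := ν) alg.best (alg.fitted z 2)).1
    have h7 := mul_nonneg (by linarith : 0 ≤ d) (hs 1 le_rfl).le
    constructor <;> linarith
  | succ m hm ih =>
    intro Q hQ
    have hs1 := hs m hm
    have hs1' := hs (m + 1) (by omega)
    have hγ := alg.gamma_nonneg z (m + 1)
    have hγs2 := gamma_mul_regretScale_le hunit hd z hm
    have hγs : alg.gamma z (m + 1) * alg.regretScale m ≤ Fintype.card 𝒜 / 2 := by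
      refine abs_le_of_sq_le_sq' ?_ (by positivity) |>.2
      nlinarith [sq_nonneg (Fintype.card 𝒜 : ℝ)]
    -- The rate at most doubles between epochs, so (γ s_{m+1})² ≤ 2K²/8. This yields exactly θγ ≤
    -- 1/4 and uses the full factor 8 in the definition of γ.
    have hγs' : alg.gamma z (m + 1) * alg.regretScale (m + 1) ≤ Fintype.card 𝒜 / 2 := by
      refine abs_le_of_sq_le_sq' ?_ (by positivity) |>.2
      have h1 : alg.regretScale (m + 1) ^ 2 ≤ 2 * alg.regretScale m ^ 2 := by
        rw [hs2 _ hm, hs2 _ (by omega)]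
        nlinarith [hunit2 m hm]
      rw [mul_pow] at hγs2 ⊢
      nlinarith [mul_le_mul_of_nonneg_left h1 (sq_nonneg (alg.gamma z (m + 1)))]
    -- The constant 5 reproduces itself: the three error terms are at most 1/2, 5/4 and 2 times d
    -- s_{m+1}, together 15/4, and 4/3 · 15/4 = 5.
    obtain ⟨h1, h2⟩ := policyRegret_le_of_estimate (alg.isPolicy_actionProb z (m + 1)) alg.best
      fstar (alg.fitted z (m + 2)) (alg.fitted z (m + 1)) (c := 5 * d * alg.regretScale m)
      (A := 15 / 4 * d * alg.regretScale (m + 1)) (div_pos hs1' (mul_pos two_pos hK)) hγ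
      (by
        rw [div_mul_eq_mul_div, div_le_iff₀ (by positivity)]
        linarith) (alg.one_le_actionProb_mul z (m + 1))
      (fun R hR => (ih R hR).2) (hest (m + 1) (by omega)) (by
        rw [hE (m + 1) (by omega)]
        have h4 : alg.regretScale (m + 1) / (2 * Fintype.card 𝒜) *
            (Fintype.card 𝒜 + alg.gamma z (m + 1) * (5 * d * alg.regretScale m)) =
            alg.regretScale (m + 1) / 2 + 5 * d * alg.regretScale (m + 1) / (2 * Fintype.card 𝒜) *
              (alg.gamma z (m + 1) * alg.regretScale m) := by field_simp
        have h5 : 5 * d * alg.regretScale (m + 1) / (2 * Fintype.card 𝒜) *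
            (alg.gamma z (m + 1) * alg.regretScale m) ≤
            5 * d * alg.regretScale (m + 1) / (2 * Fintype.card 𝒜) * (Fintype.card 𝒜 / 2) := by
          gcongr
        have h6 : 5 * d * alg.regretScale (m + 1) / (2 * Fintype.card 𝒜) * (Fintype.card 𝒜 / 2) =
          5 / 4 * (d * alg.regretScale (m + 1)) := by field_simp; ring
        rw [h4]
        nlinarith) hQ
    have h5 := (hQ.policyRegret_mem_Icc (ν := ν) alg.best fstar).1
    have h6 := (hQ.policyRegret_mem_Icc (ν := ν) alg.best (alg.fitted z (m + 2))).1
    have h7 := mul_nonneg (by linarith : 0 ≤ d) hs1'.le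
    constructor <;> linarith

/-- The expected regret of the algorithm in an epoch after the first one. -/
lemma policyRegret_actionProb_le (hd1 : 1 ≤ d) (hunit : ∀ m, 1 ≤ m → 0 < alg.unitRate m)
    (hunit2 : ∀ m, 1 ≤ m → alg.unitRate (m + 1) ≤ 2 * alg.unitRate m)
    (hd : ∀ i, 1 ≤ alg.d i)
    (hest : ∀ m, 1 ≤ m → ∫ x, ∑ a, alg.actionProb z m x a *
      (alg.fitted z (m + 1) x a - fstar x a) ^ 2 ∂ν ≤ d * alg.unitRate m)
    {m : ℕ} (hm : 1 ≤ m) (hindex : (alg.d (alg.index z (m + 1)) : ℝ) ≤ d) :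
    policyRegret ν alg.best fstar (alg.actionProb z (m + 1)) ≤ 11 * d * alg.regretScale m := by
  have hK : (0 : ℝ) < Fintype.card 𝒜 := by exact_mod_cast Fintype.card_pos
  have hs : 0 < alg.regretScale m := Real.sqrt_pos.2 (mul_pos hK (hunit m hm))
  have hpol := alg.isPolicy_actionProb z (m + 1)
  have h1 := (policyRegret_comparable hd1 hunit hunit2 hd hest hm _ hpol).1
  have h2 := gamma_sq_mul_regretScale_sq hunit hd z hm
  have hγ := alg.gamma_nonneg z (m + 1)
  -- The selected dimension is at most d ≤ d², so 8 times it is at most (3d)². This turns the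
  -- own-model regret K/γ into 3 d s_m, and 2 · 3 + 5 = 11.
  have h3 : (Fintype.card 𝒜 : ℝ) ≤ alg.gamma z (m + 1) * (3 * d * alg.regretScale m) := by
    refine abs_le_of_sq_le_sq' ?_ (by positivity) |>.2
    have h4 := mul_le_mul_of_nonneg_left (hindex.trans (by nlinarith : d ≤ d ^ 2))
      (sq_nonneg (alg.gamma z (m + 1) * alg.regretScale m))
    have h5 := mul_nonneg (sq_nonneg (alg.gamma z (m + 1) * alg.regretScale m)) (sq_nonneg d)
    nlinarith
  have h4 : alg.gamma z (m + 1) * policyRegret ν alg.best (alg.fitted z (m + 1))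
      (alg.actionProb z (m + 1)) ≤ Fintype.card 𝒜 := by
    rw [policyRegret, ← integral_const_mul]
    calc _ ≤ ∫ _, (Fintype.card 𝒜 : ℝ) ∂ν := integral_mono
          ((hpol.integrable_gap alg.best _).const_mul _) (integrable_const _)
          fun x => alg.gamma_mul_sum_actionProb_mul_gap_le z (m + 1) x
      _ = _ := by simp
  have hγ' : 0 < alg.gamma z (m + 1) := hγ.lt_of_ne fun h0 => by
    rw [← h0, zero_mul] at h3; linarith
  have h5 := le_of_mul_le_mul_left (h4.trans h3) hγ'
  linarith

end ModIGW

end ContextualBandit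

namespace ContextualBandit

/-! ### The estimation rates -/

namespace ModIGW

variable {𝒳 𝒜 : Type*} [MeasurableSpace 𝒳] [MeasurableSpace 𝒜] {M : ℕ} [NeZero M]
  {alg : ModIGW 𝒳 𝒜 M}

lemma one_div_conf (alg : ModIGW 𝒳 𝒜 M) (m : ℕ) :
    1 / alg.conf m = 4 * M * (m : ℝ) ^ 2 / alg.δ := by
  rw [conf, one_div_div]

lemma four_le_one_div_conf (hδ0 : 0 < alg.δ) (hδ1 : alg.δ < 1) {m : ℕ} (hm : 1 ≤ m) :
    4 * (m : ℝ) ^ 2 ≤ 1 / alg.conf m := by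
  have hM : (1 : ℝ) ≤ M := by exact_mod_cast NeZero.one_le
  rw [one_div_conf, le_div_iff₀ hδ0]
  have : 0 ≤ 4 * (m : ℝ) ^ 2 := by positivity
  nlinarith

lemma log_one_div_conf_pos (hδ0 : 0 < alg.δ) (hδ1 : alg.δ < 1) {m : ℕ} (hm : 1 ≤ m) :
    0 < Real.log (1 / alg.conf m) := by
  have h1 : (1 : ℝ) ≤ m := by exact_mod_cast hm
  exact Real.log_pos (by nlinarith [four_le_one_div_conf hδ0 hδ1 hm])

lemma unitRate_eq (alg : ModIGW 𝒳 𝒜 M) (m : ℕ) : alg.unitRate m =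
    alg.C₁ * (Real.log (epochLength alg.τ₁ m) / epochLength alg.τ₁ m) *
      Real.log (1 / alg.conf m) := by
  simp only [unitRate, rate, Nat.cast_one]
  ring

lemma unitRate_pos (hτ : 2 ≤ alg.τ₁) (hδ0 : 0 < alg.δ) (hδ1 : alg.δ < 1) (hC : 0 < alg.C₁)
    {m : ℕ} (hm : 1 ≤ m) : 0 < alg.unitRate m := by
  have h2 : (2 : ℝ) ≤ epochLength alg.τ₁ m := by exact_mod_cast hτ.trans (le_epochLength hm)
  have h3 := log_one_div_conf_pos hδ0 hδ1 hm
  have h4 : 0 < Real.log (epochLength alg.τ₁ m) := Real.log_pos (by linarith)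
  rw [unitRate_eq]
  positivity

/-- Only the confidence term can grow. Passing to the next epoch multiplies 1/conf by at most 4, and
1/conf is itself at least 4, so its logarithm at most doubles. The ratio log n / n does not increase
when n ≥ 2 doubles; the first two epochs have equal length. -/
lemma unitRate_succ_le (hτ : 2 ≤ alg.τ₁) (hδ0 : 0 < alg.δ) (hδ1 : alg.δ < 1) (hC : 0 < alg.C₁)
    {m : ℕ} (hm : 1 ≤ m) : alg.unitRate (m + 1) ≤ 2 * alg.unitRate m := by
  have hm' : (1 : ℝ) ≤ m := by exact_mod_cast hm
  have hM : (1 : ℝ) ≤ M := by exact_mod_cast NeZero.one_le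
  have h2 : (2 : ℝ) ≤ epochLength alg.τ₁ m := by exact_mod_cast hτ.trans (le_epochLength hm)
  have hlog : Real.log (epochLength alg.τ₁ (m + 1)) / epochLength alg.τ₁ (m + 1) ≤
      Real.log (epochLength alg.τ₁ m) / epochLength alg.τ₁ m := by
    obtain _ | _ | m := m
    · omega
    · rw [epochLength_add_two, epochLength_one]; simp
    · have hdouble : (epochLength alg.τ₁ (m + 2 + 1) : ℝ) = 2 * epochLength alg.τ₁ (m + 2) := by
        rw [show m + 2 + 1 = m + 1 + 2 by ring, epochLength_add_two, epochLength_add_two]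
        push_cast; ring
      rw [hdouble, Real.log_mul two_ne_zero (by positivity),
        div_le_div_iff₀ (by positivity) (by positivity)]
      have := Real.log_le_log two_pos h2
      nlinarith
  have hconf : Real.log (1 / alg.conf (m + 1)) ≤ 2 * Real.log (1 / alg.conf m) := by
    have h4 := four_le_one_div_conf hδ0 hδ1 hm
    have hpos : 0 < 1 / alg.conf m := by nlinarith
    rw [show (2 : ℝ) * Real.log (1 / alg.conf m) = Real.log ((1 / alg.conf m) ^ 2) by
      rw [Real.log_pow]; norm_num]
    refine Real.log_le_log ?_ ?_
    · rw [one_div_conf]; positivity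
    · have h5 : 1 / alg.conf (m + 1) ≤ 4 * (1 / alg.conf m) := by
        rw [one_div_conf, one_div_conf, ← mul_div_assoc]
        refine div_le_div_of_nonneg_right ?_ hδ0.le
        have : ((m + 1 : ℕ) : ℝ) ^ 2 ≤ 4 * (m : ℝ) ^ 2 := by push_cast; nlinarith
        nlinarith
      have h6 : 4 ≤ 1 / alg.conf m := by nlinarith
      nlinarith
  rw [unitRate_eq, unitRate_eq]
  have h3 := log_one_div_conf_pos hδ0 hδ1 hm
  have h4 : 0 ≤ Real.log (epochLength alg.τ₁ m) / epochLength alg.τ₁ m :=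
    div_nonneg (Real.log_nonneg (by linarith)) (by linarith)
  calc _ ≤ alg.C₁ * (Real.log (epochLength alg.τ₁ m) / epochLength alg.τ₁ m) *
        (2 * Real.log (1 / alg.conf m)) := by
        have := (log_one_div_conf_pos (alg := alg) hδ0 hδ1 (Nat.le_add_left 1 m)).le
        gcongr
    _ = _ := by ring

end ModIGW

/-! ### Failure probabilities -/

section Failure

variable {𝒳 𝒜 Ω : Type*} [MeasurableSpace 𝒳] [MeasurableSpace 𝒜] [mΩ : MeasurableSpace Ω]
  {x : ℕ → Ω → 𝒳} {r : ℕ → Ω → 𝒜 → unitInterval} {a : ℕ → Ω → 𝒜} {M : ℕ} [NeZero M]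
  {alg : ModIGW 𝒳 𝒜 M} {D : Measure (𝒳 × (𝒜 → unitInterval))} {P : Measure Ω}
  [IsProbabilityMeasure D] {fstar : Model 𝒳 𝒜} {F : Fin M → Set (Model 𝒳 𝒜)}
  {iStar : Fin M} {C₀ : ℝ}

lemma sqDist_nonneg (p : Kernel 𝒳 𝒜) (f g : Model 𝒳 𝒜) : 0 ≤ sqDist D p f g :=
  integral_nonneg fun _ => integral_nonneg fun _ => sq_nonneg _

lemma sqDist_le_one (p : Kernel 𝒳 𝒜) [IsMarkovKernel p] (f g : Model 𝒳 𝒜) :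
    sqDist D p f g ≤ 1 := by
  have h1 : ∀ y, ‖∫ b, (f y b - g y b) ^ 2 ∂(p y)‖ ≤ 1 := fun y => by
    refine (norm_integral_le_of_norm_le_const (C := 1) (ae_of_all _ fun b => ?_)).trans (by simp)
    rw [Real.norm_of_nonneg (sq_nonneg _), ← sq_abs]
    exact pow_le_one₀ (abs_nonneg _) (f.abs_sub_le_one g y b)
  refine (Real.le_norm_self _).trans ?_
  exact (norm_integral_le_of_norm_le_const (ae_of_all _ h1)).trans (by simp)

/-- A real supremum dominates its members only if the family is bounded above; here 1 is a bound,
witnessed by any model of the class. -/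
lemma misspec_le_maxMisspec {G : Set (Model 𝒳 𝒜)} (hG : G.Nonempty) (p : Kernel 𝒳 𝒜)
    [hp : IsMarkovKernel p] : misspec D fstar G p ≤ maxMisspec D fstar G := by
  refine le_ciSup (f := fun p : {p : Kernel 𝒳 𝒜 // IsMarkovKernel p} => misspec D fstar G p)
    ⟨1, ?_⟩ ⟨p, hp⟩
  rintro _ ⟨⟨q, hq⟩, rfl⟩
  obtain ⟨f, hf⟩ := hG
  refine (ciInf_le ⟨0, ?_⟩ (⟨f, hf⟩ : G)).trans (sqDist_le_one q f fstar)
  rintro _ ⟨g, rfl⟩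
  exact sqDist_nonneg q g fstar

lemma epochEndExt_top {τ : ℕ} (hτ : 2 ≤ τ) : epochEndExt τ ⊤ = ∞ := by
  simp only [epochEndExt, le_top, iSup_pos]
  refine ENNReal.eq_top_of_forall_nnreal_le fun c => ?_
  obtain ⟨n, hn⟩ := exists_nat_ge c
  refine le_iSup_of_le n ?_
  calc (c : ℝ≥0∞) ≤ (n : ℝ≥0∞) := by exact_mod_cast hn
    _ ≤ _ := by exact_mod_cast lt_epochEnd hτ n

/-- For a realizable class the minimum of the B's is at most zero, so every epoch's rate, being
nonnegative, exceeds the threshold. -/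
lemma safeEpoch_eq_top (hτ : 2 ≤ alg.τ₁) (hδ0 : 0 < alg.δ) (hδ1 : alg.δ < 1) (hC : 0 < alg.C₁)
    (hi : maxMisspec D fstar (F iStar) = 0) (hC₀ : 1 ≤ C₀) :
    safeEpoch alg D fstar F C₀ iStar = ⊤ := by
  have hinf : (⨅ i' : Set.Iic iStar, maxMisspec D fstar (F i')) ≤ 0 :=
    (ciInf_le (Set.finite_range _).bddBelow (⟨iStar, Set.mem_Iic.2 le_rfl⟩ : Set.Iic iStar)).trans hi.le
  refine ENat.eq_top_iff_forall_ge.2 fun k => ?_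
  refine le_trans (b := ((k + 1 : ℕ) : ℕ∞)) (by exact_mod_cast Nat.le_succ k)
    (le_iSup₂_of_le (k + 1) ⟨by omega, ?_⟩ le_rfl)
  rw [ModIGW.ξ_eq_mul_unitRate]
  have h1 := (ModIGW.unitRate_pos hτ hδ0 hδ1 hC (Nat.le_add_left 1 k)).le
  have h2 : 0 ≤ (alg.d iStar : ℝ) * alg.unitRate (k + 1) := by positivity
  nlinarith

lemma ModIGW.conf_pos (hδ0 : 0 < alg.δ) {m : ℕ} (hm : 1 ≤ m) : 0 < alg.conf m := by
  have h1 : (1 : ℝ) ≤ m := by exact_mod_cast hm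
  have hM : (1 : ℝ) ≤ M := by exact_mod_cast NeZero.one_le
  unfold conf
  positivity

lemma ModIGW.conf_le (hδ0 : 0 < alg.δ) {m : ℕ} (hm : 1 ≤ m) :
    alg.conf m ≤ alg.δ / (4 * (m : ℝ) ^ 2) := by
  have h1 : (1 : ℝ) ≤ m := by exact_mod_cast hm
  have hM : (1 : ℝ) ≤ M := by exact_mod_cast NeZero.one_le
  unfold conf
  gcongr
  nlinarith

lemma div_four_mul_sq_lt_one {δ : ℝ} (hδ1 : δ < 1) {m : ℕ} (hm : 1 ≤ m) :
    δ / (4 * (m : ℝ) ^ 2) < 1 := by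
  have h1 : (1 : ℝ) ≤ m := by exact_mod_cast hm
  rw [div_lt_one (by positivity)]
  nlinarith

/-! ### Failure events of an epoch and their union -/

variable [Fintype 𝒜] [DecidableEq 𝒜] [MeasurableSingletonClass 𝒜] [Nonempty 𝒜]
  [IsProbabilityMeasure P]

/-- The first realizable class is rarely rejected. -/
lemma IsRun.measure_test_le (h : IsRun alg D P x r a) (hτ : 2 ≤ alg.τ₁) (hδ0 : 0 < alg.δ)
    (hδ1 : alg.δ < 1) (hC : 0 < alg.C₁) (hi : maxMisspec D fstar (F iStar) = 0) (hC₀ : 1 ≤ C₀)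
    (htest : TestGuarantee alg D fstar F C₀ P (observations x r a)) {m : ℕ} (hm : 1 ≤ m) :
    P {ω | alg.mt.test iStar _ (alg.sample (observations x r a ω) m) (alg.conf m) = false}ᶜ ≤
      ENNReal.ofReal (alg.δ / (4 * (m : ℝ) ^ 2)) := by
  obtain ⟨β', β, -, hβ', -, -, hguar⟩ := htest
  have hconf := (ModIGW.conf_le (alg := alg) hδ0 hm)
  have hsafe := (hguar iStar m hm (alg.conf m) (ModIGW.conf_pos hδ0 hm)
    (hconf.trans_lt (div_four_mul_sq_lt_one hδ1 hm))).1 (by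
      rw [safeEpoch_eq_top hτ hδ0 hδ1 hC hi hC₀, epochEndExt_top hτ,
        ENNReal.mul_top (hβ' iStar).1.ne']
      exact le_top)
  refine (prob_compl_le ?_ hsafe).trans (ENNReal.ofReal_le_ofReal hconf)
  exact ((alg.mt.measurable_test iStar _ _).comp ((alg.measurable_sample m).comp
    h.measurable_observations')) (measurableSet_singleton false)

/-- The estimated model of the next epoch is rarely inaccurate. -/
lemma IsRun.measure_estimate_le (h : IsRun alg D P x r a) (hτ : 2 ≤ alg.τ₁) (hδ0 : 0 < alg.δ)
    (hδ1 : alg.δ < 1) (hF : (F iStar).Nonempty)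
    (hi : maxMisspec D fstar (F iStar) = 0) (hC₀ : 1 ≤ C₀)
    (hest : EstimationGuarantee alg D fstar F C₀) {m : ℕ} (hm : 1 ≤ m) :
    P {ω | alg.d iStar * alg.unitRate m < sqDist D (alg.actionKernel (observations x r a ω) m)
      (alg.fitted (observations x r a ω) (m + 1)) fstar} ≤
      ENNReal.ofReal (alg.δ / (4 * (m : ℝ) ^ 2)) := by
  have h1 : (1 : ℝ) ≤ m := by exact_mod_cast hm
  have hM : (1 : ℝ) ≤ M := by exact_mod_cast NeZero.one_le
  refine h.measure_lt_sqDist_fitted_le fstar hm fun z => ?_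
  -- The oracle for the last class is used at level δ/(4m²). It divides this by M, which gives
  -- exactly the level δ/(4Mm²) in the rates of the algorithm.
  refine (hest ⊤ (alg.actionKernel z m) inferInstance _ (hτ.trans (le_epochLength hm)) _
    (by positivity) (div_four_mul_sq_lt_one hδ1 hm)).trans (measure_mono fun S hS => ?_)
  rw [Set.mem_ofPred_eq] at hS ⊢
  refine hS.trans ?_
  refine (ciInf_le (Set.finite_range _).bddBelow (⟨iStar, Set.mem_Iic.2 le_top⟩ : Set.Iic (⊤ : Fin M))).trans ?_
  have htop : (((⊤ : Fin M) : ℕ) : ℝ) + 1 = M := by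
    have : ((⊤ : Fin M) : ℕ) + 1 = M := by
      have h2 := NeZero.one_le (n := M)
      have h3 : (⟨M - 1, by omega⟩ : Fin M) ≤ ⊤ := le_top
      have h4 := (⊤ : Fin M).2
      have h5 : M - 1 ≤ ((⊤ : Fin M) : ℕ) := h3
      omega
    exact_mod_cast this
  have hconf : alg.δ / (4 * (m : ℝ) ^ 2) / M = alg.conf m := by
    rw [ModIGW.conf, div_div]; ring_nf
  rw [htop, hconf, ModIGW.ξ_eq_mul_unitRate]
  have h2 := misspec_le_maxMisspec (D := D) (fstar := fstar) hF (alg.actionKernel z m)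
  rw [hi] at h2
  nlinarith

/-- Each index contributes failure probabilities δ/4, δ/4 and δ/16 over (k+1)², for estimation,
testing and concentration. The sum stays below δ because 9/16 · π²/6 < 1. -/
lemma tsum_ofReal_div_sq_le {δ : ℝ} (hδ : 0 ≤ δ) :
    ∑' k : ℕ, ENNReal.ofReal (9 / 16 * δ / ((k + 1 : ℕ) : ℝ) ^ 2) ≤ ENNReal.ofReal δ := by
  have h1 : HasSum (fun k : ℕ => 1 / ((k + 1 : ℕ) : ℝ) ^ 2) (Real.pi ^ 2 / 6) := by
    have h2 := (hasSum_nat_add_iff' 1).2 hasSum_zeta_two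
    simpa using h2
  have h2 : HasSum (fun k : ℕ => 9 / 16 * δ / ((k + 1 : ℕ) : ℝ) ^ 2)
      (9 / 16 * δ * (Real.pi ^ 2 / 6)) := by
    simpa only [mul_one_div] using h1.mul_left (9 / 16 * δ)
  rw [← ENNReal.ofReal_tsum_of_nonneg (fun k => by positivity) h2.summable, h2.tsum_eq]
  refine ENNReal.ofReal_le_ofReal ?_
  have h3 := Real.pi_lt_d2
  have h4 : Real.pi ^ 2 ≤ 10 := by nlinarith [Real.pi_pos]
  nlinarith

/-- Subadditivity, applied to the cover of the space by the bad sets and `S`, requires no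
measurability of any of them. -/
lemma ofReal_one_sub_le_of_union {S : Set Ω} {δ : ℝ} (hδ : 0 ≤ δ) {bad : ℕ → Set Ω}
    (hbad : ∀ k, P (bad k) ≤ ENNReal.ofReal (9 / 16 * δ / ((k + 1 : ℕ) : ℝ) ^ 2))
    (hS : ∀ ω, (∀ k, ω ∉ bad k) → ω ∈ S) : ENNReal.ofReal (1 - δ) ≤ P S := by
  have h1 : P (⋃ k, bad k) ≤ ENNReal.ofReal δ :=
    (measure_iUnion_le bad).trans ((ENNReal.tsum_le_tsum hbad).trans (tsum_ofReal_div_sq_le hδ))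
  have h2 : (1 : ℝ≥0∞) ≤ P (⋃ k, bad k) + P S := by
    rw [← measure_univ (μ := P)]
    refine (measure_mono fun ω _ => ?_).trans (measure_union_le _ _)
    by_cases hω : ω ∈ ⋃ k, bad k
    · exact Or.inl hω
    · exact Or.inr (hS ω fun k hk => hω (Set.mem_iUnion.2 ⟨k, hk⟩))
  rw [ENNReal.ofReal_sub _ hδ, ENNReal.ofReal_one, tsub_le_iff_left]
  exact h2.trans (by gcongr)

end Failure

end ContextualBandit

namespace ContextualBandit

/-! ### Summing up the regret -/

/-- Since e < 3, this is a positive lower bound for log(M log t/δ) when t ≥ 3. Dividing by it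
absorbs additive constants into that logarithm. -/
lemma log_log_three_pos : 0 < Real.log (Real.log 3) := by
  refine Real.log_pos ((Real.lt_log_iff_exp_lt (by norm_num)).2 ?_)
  exact Real.exp_one_lt_three

/-- The constant of the regret bound. -/
def regretConst (C₁ : ℝ) (τ₁ : ℕ) : ℝ :=
  44 * Real.sqrt ((2 + Real.log 16 / Real.log (Real.log 3)) * C₁) +
    Real.sqrt (((Real.log 16 + 2) / Real.log (Real.log 3) + 1) / 2) +
    τ₁ / Real.sqrt (Real.log (Real.log 3))

/-- Telescoping: 1/√(t+1) ≤ 2√(t+1) - 2√t. -/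
lemma sum_inv_sqrt_le (t : ℕ) :
    ∑ s ∈ Finset.Icc 1 t, 1 / Real.sqrt s ≤ 2 * Real.sqrt t := by
  induction t with
  | zero => simp
  | succ t ih =>
    rw [Finset.sum_Icc_succ_top (by omega)]
    have h1 : 0 < Real.sqrt ((t + 1 : ℕ) : ℝ) := Real.sqrt_pos.2 (by positivity)
    have h2 : Real.sqrt ((t + 1 : ℕ) : ℝ) ^ 2 = t + 1 := by
      rw [Real.sq_sqrt (by positivity)]; push_cast; rfl
    have h3 : Real.sqrt (t : ℝ) ^ 2 = t := Real.sq_sqrt (by positivity)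
    have h4 : 1 / Real.sqrt ((t + 1 : ℕ) : ℝ) ≤
        2 * Real.sqrt ((t + 1 : ℕ) : ℝ) - 2 * Real.sqrt t := by
      rw [div_le_iff₀ h1]
      nlinarith [sq_nonneg (Real.sqrt ((t + 1 : ℕ) : ℝ) - Real.sqrt t)]
    linarith

section Logarithms

variable {M t : ℕ} {δ : ℝ}

lemma log_three_le (ht : 3 ≤ t) : Real.log 3 ≤ Real.log t :=
  Real.log_le_log (by norm_num) (by exact_mod_cast ht)

lemma one_lt_log_three : 1 < Real.log 3 :=
  (Real.lt_log_iff_exp_lt (by norm_num)).2 Real.exp_one_lt_three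

lemma log_div_le (hM : 1 ≤ M) (ht : 3 ≤ t) (hδ0 : 0 < δ) :
    Real.log t / δ ≤ M * Real.log t / δ := by
  have hM' : (1 : ℝ) ≤ M := by exact_mod_cast hM
  have h1 := one_lt_log_three.le.trans (log_three_le ht)
  gcongr
  nlinarith

lemma log_log_three_le (hM : 1 ≤ M) (ht : 3 ≤ t) (hδ0 : 0 < δ) (hδ1 : δ < 1) :
    Real.log (Real.log 3) ≤ Real.log (M * Real.log t / δ) := by
  have h1 := one_lt_log_three
  refine Real.log_le_log (by linarith) (le_trans ?_ (log_div_le hM ht hδ0))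
  rw [le_div_iff₀ hδ0]
  nlinarith [log_three_le ht]

lemma log_one_div_le (hM : 1 ≤ M) (ht : 3 ≤ t) (hδ0 : 0 < δ) :
    Real.log (1 / δ) ≤ Real.log (M * Real.log t / δ) := by
  refine Real.log_le_log (by positivity) (le_trans ?_ (log_div_le hM ht hδ0))
  have h1 := one_lt_log_three.le.trans (log_three_le ht)
  gcongr

/-- The logarithm in the concentration bound is of the order of that in the regret bound. -/
lemma log_one_div_div_sixteen_sq_le (hM : 1 ≤ M) (ht : 3 ≤ t) (hδ0 : 0 < δ) (hδ1 : δ < 1) :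
    Real.log (1 / (δ / (16 * (t : ℝ) ^ 2))) ≤
      ((Real.log 16 + 2) / Real.log (Real.log 3) + 1) *
        (Real.log t * Real.log (M * Real.log t / δ)) := by
  have ht' : (0 : ℝ) < t := by exact_mod_cast (by omega : 0 < t)
  have h1 := one_lt_log_three.le.trans (log_three_le ht)
  have h2 := log_log_three_pos
  have h3 := log_log_three_le hM ht hδ0 hδ1
  have h4 := log_one_div_le hM ht hδ0
  have h5 : 0 < Real.log 16 := Real.log_pos (by norm_num)
  rw [show 1 / (δ / (16 * (t : ℝ) ^ 2)) = 16 * (t : ℝ) ^ 2 * (1 / δ) by field_simp,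
    Real.log_mul (by positivity) (by positivity), Real.log_mul (by norm_num) (by positivity),
    Real.log_pow]
  set L := Real.log t
  set Λ := Real.log (M * L / δ)
  set κ := Real.log (Real.log 3)
  have h6 : 1 ≤ Λ / κ := (one_le_div h2).2 h3
  have h7 : (Real.log 16 + 2) * L ≤ (Real.log 16 + 2) * L * (Λ / κ) :=
    le_mul_of_one_le_right (by positivity) h6
  have h8 : ((Real.log 16 + 2) / κ + 1) * (L * Λ) =
    (Real.log 16 + 2) * L * (Λ / κ) + L * Λ := by field_simp
  have h9 : Λ ≤ L * Λ := le_mul_of_one_le_left (by linarith) h1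
  rw [h8]
  push_cast
  nlinarith

end Logarithms

section Bound

variable {𝒳 𝒜 : Type*} [MeasurableSpace 𝒳] [MeasurableSpace 𝒜] {M : ℕ} [NeZero M]
  {alg : ModIGW 𝒳 𝒜 M}

lemma two_pow_le_epochEnd {τ m : ℕ} (hτ : 2 ≤ τ) (hm : 1 ≤ m) : 2 ^ m ≤ epochEnd τ m := by
  obtain ⟨k, rfl⟩ := Nat.exists_eq_add_of_le' hm
  rw [epochEnd_succ, pow_succ]
  gcongr

lemma epochEnd_succ_le_four_mul {τ m : ℕ} (hm : 1 ≤ m) :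
    epochEnd τ (m + 1) ≤ 4 * epochLength τ m := by
  obtain _ | _ | m := m
  · omega
  · rw [epochLength_one, epochEnd_succ]; omega
  · rw [epochLength_add_two, epochEnd_succ, pow_add]; apply le_of_eq; ring

/-- The model used in round s was fitted on at least s/4 samples. Since epochs double, m is at most
2 log t, so the factor m² inside the confidence level costs only a log t inside the logarithm. -/
lemma ModIGW.unitRate_le (hτ : 2 ≤ alg.τ₁) (hδ0 : 0 < alg.δ) (hδ1 : alg.δ < 1) (hC : 0 < alg.C₁)
    {m s t : ℕ} (hm : 1 ≤ m) (hs : epochEnd alg.τ₁ m < s) (hs' : s ≤ epochEnd alg.τ₁ (m + 1))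
    (hst : s ≤ t) (ht : 3 ≤ t) :
    alg.unitRate m ≤ 4 * (2 + Real.log 16 / Real.log (Real.log 3)) * alg.C₁ *
      (Real.log t * Real.log (M * Real.log t / alg.δ)) / s := by
  have hM : 1 ≤ M := NeZero.one_le
  have hM' : (1 : ℝ) ≤ M := by exact_mod_cast hM
  have h1 := one_lt_log_three.le.trans (log_three_le ht)
  have h2 := log_log_three_pos
  have h3 := log_log_three_le hM ht hδ0 hδ1
  have h5 : 0 < Real.log 16 := Real.log_pos (by norm_num)
  have hm' : (1 : ℝ) ≤ m := by exact_mod_cast hm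
  have ht' : (0 : ℝ) < t := by exact_mod_cast (by omega : 0 < t)
  have hs0 : (0 : ℝ) < s := by exact_mod_cast (by omega : 0 < s)
  have hn2 : (2 : ℝ) ≤ epochLength alg.τ₁ m := by exact_mod_cast hτ.trans (le_epochLength hm)
  have hnt : (epochLength alg.τ₁ m : ℝ) ≤ t := by
    have := epochEnd_pred_add_epochLength alg.τ₁ m
    exact_mod_cast (by omega : epochLength alg.τ₁ m ≤ t)
  have hns : (s : ℝ) ≤ 4 * epochLength alg.τ₁ m := by
    exact_mod_cast hs'.trans (epochEnd_succ_le_four_mul hm)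
  have hmL : (m : ℝ) ≤ 2 * Real.log t := by
    have h6 : ((2 : ℝ) ^ m) ≤ t := by
      exact_mod_cast (two_pow_le_epochEnd hτ hm).trans (hs.le.trans hst)
    have h7 := Real.log_le_log (by positivity) h6
    rw [Real.log_pow] at h7
    nlinarith [Real.log_two_gt_d9]
  have hlogn : Real.log (epochLength alg.τ₁ m) ≤ Real.log t :=
    Real.log_le_log (by linarith) hnt
  have hconf : Real.log (1 / alg.conf m) ≤
      (2 + Real.log 16 / Real.log (Real.log 3)) * Real.log (M * Real.log t / alg.δ) := by
    have hpos : 0 < M * Real.log t / alg.δ := by positivity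
    -- A square on the right lets M ≤ M² and δ² ≤ δ be absorbed; it only doubles the logarithm.
    have h6 : 1 / alg.conf m ≤ 16 * (M * Real.log t / alg.δ) ^ 2 := by
      rw [one_div_conf, div_pow, ← mul_div_assoc, div_le_div_iff₀ hδ0 (by positivity)]
      have h7 : (m : ℝ) ^ 2 ≤ 4 * Real.log t ^ 2 := by nlinarith
      calc 4 * M * (m : ℝ) ^ 2 * alg.δ ^ 2 ≤ 4 * M * (4 * Real.log t ^ 2) * (alg.δ * 1) := by
            rw [sq alg.δ]; gcongr
        _ ≤ 4 * (M * M) * (4 * Real.log t ^ 2) * (alg.δ * 1) := by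
            gcongr; nlinarith
        _ = _ := by ring
    have h7 : Real.log (1 / alg.conf m) ≤ Real.log (16 * (M * Real.log t / alg.δ) ^ 2) :=
      Real.log_le_log (by nlinarith [four_le_one_div_conf hδ0 hδ1 hm]) h6
    rw [Real.log_mul (by norm_num) (by positivity), Real.log_pow] at h7
    have h8 : Real.log 16 ≤ Real.log 16 / Real.log (Real.log 3) *
        Real.log (M * Real.log t / alg.δ) := by
      rw [div_mul_eq_mul_div, le_div_iff₀ h2]
      gcongr
    push_cast at h7
    linarith
  have hΛ : 0 < Real.log (M * Real.log t / alg.δ) := h2.trans_le h3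
  rw [unitRate_eq]
  calc _ ≤ alg.C₁ * (Real.log t / (s / 4)) * ((2 + Real.log 16 / Real.log (Real.log 3)) *
        Real.log (M * Real.log t / alg.δ)) := by
        have := (log_one_div_conf_pos (alg := alg) hδ0 hδ1 hm).le
        gcongr
        linarith
    _ = _ := by field_simp

variable [Fintype 𝒜] [DecidableEq 𝒜] [MeasurableSingletonClass 𝒜] [Nonempty 𝒜]
  {D : Measure (𝒳 × (𝒜 → unitInterval))} [IsProbabilityMeasure D] {fstar : Model 𝒳 𝒜}

/-- The regret bound on the event that no oracle fails and the regret concentrates. -/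
lemma sum_gap_le {z : ℕ → Obs 𝒳 𝒜} {d : ℝ} (hd1 : 1 ≤ d) (hτ : 2 ≤ alg.τ₁) (hδ0 : 0 < alg.δ)
    (hδ1 : alg.δ < 1) (hC : 0 < alg.C₁) (hd : ∀ i, 1 ≤ alg.d i)
    (hest : ∀ m, 1 ≤ m → sqDist D (alg.actionKernel z m) (alg.fitted z (m + 1)) fstar ≤
      d * alg.unitRate m)
    (hindex : ∀ m, (alg.d (alg.index z m) : ℝ) ≤ d)
    {epoch : ℕ → ℕ} (hepoch : ∀ s, 1 ≤ s → 1 ≤ epoch s ∧ epochEnd alg.τ₁ (epoch s - 1) < s ∧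
      s ≤ epochEnd alg.τ₁ (epoch s)) {t : ℕ} (ht : 3 ≤ t)
    (hdev : regretDeviation alg D fstar epoch z t ≤
      Real.sqrt (t * Real.log (1 / (alg.δ / (16 * (t : ℝ) ^ 2))) / 2)) :
    ∑ s ∈ Finset.Icc 1 t, gap alg.best fstar (z s).1 (z s).2.1 ≤
      regretConst alg.C₁ alg.τ₁ * (d * Real.sqrt (Fintype.card 𝒜 * t * Real.log t *
        Real.log (M * Real.log t / alg.δ))) := by
  have hM : 1 ≤ M := NeZero.one_le
  have hK : (1 : ℝ) ≤ Fintype.card 𝒜 := by exact_mod_cast Fintype.card_pos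
  have h1 := one_lt_log_three.le.trans (log_three_le ht)
  have h2 := log_log_three_pos
  have h3 := log_log_three_le hM ht hδ0 hδ1
  have h5 : 0 < Real.log 16 := Real.log_pos (by norm_num)
  have ht' : (1 : ℝ) ≤ t := by exact_mod_cast (by omega : 1 ≤ t)
  have hlogs := log_one_div_div_sixteen_sq_le hM ht hδ0 hδ1
  have hrate := fun {m s : ℕ} hm hs hs' hst =>
    ModIGW.unitRate_le (alg := alg) (m := m) (s := s) (t := t) hτ hδ0 hδ1 hC hm hs hs' hst ht
  set L := Real.log t with hL
  set Λ := Real.log (M * L / alg.δ) with hΛ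
  set κ := Real.log (Real.log 3) with hκ
  have hΛ0 : 0 < Λ := h2.trans_le h3
  set X := Real.sqrt (Fintype.card 𝒜 * t * L * Λ) with hX
  have hX0 : 0 ≤ X := Real.sqrt_nonneg _
  -- expected regret of one round
  have hround : ∀ s ∈ Finset.Icc 1 t,
      policyRegret D.fst alg.best fstar (alg.actionProb z (epoch s)) ≤
        (if s ≤ alg.τ₁ then 1 else 0) +
          11 * d * (Real.sqrt (4 * (2 + Real.log 16 / κ) * alg.C₁ * (L * Λ) * Fintype.card 𝒜) *
            (1 / Real.sqrt s)) := by
    intro s hs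
    obtain ⟨hs1, hs2⟩ := Finset.mem_Icc.1 hs
    obtain ⟨he1, he2, he3⟩ := hepoch s hs1
    have hnn : 0 ≤ 11 * d * (Real.sqrt (4 * (2 + Real.log 16 / κ) * alg.C₁ * (L * Λ) *
      Fintype.card 𝒜) * (1 / Real.sqrt s)) := by positivity
    obtain ⟨k, hk⟩ := Nat.exists_eq_add_of_le' he1
    rw [hk] at he2 he3 ⊢
    obtain _ | k := k
    -- The first epoch has no fitted model; the trivial bound 1 per round totals at most τ₁.
    · have hs3 : s ≤ alg.τ₁ := by simpa [epochEnd] using he3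
      rw [if_pos hs3]
      have := ((alg.isPolicy_actionProb z 1).policyRegret_mem_Icc (ν := D.fst) alg.best fstar).2
      linarith
    · have hreg := ModIGW.policyRegret_actionProb_le (ν := D.fst) (fstar := fstar) (z := z) hd1
        (fun m hm => ModIGW.unitRate_pos hτ hδ0 hδ1 hC hm)
        (fun m hm => ModIGW.unitRate_succ_le hτ hδ0 hδ1 hC hm) hd
        (fun m hm => by rw [← ModIGW.sqDist_actionKernel]; exact hest m hm)
        (Nat.le_add_left 1 k) (hindex (k + 1 + 1))
      have hscale : alg.regretScale (k + 1) ≤ Real.sqrt (4 * (2 + Real.log 16 / κ) * alg.C₁ *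
          (L * Λ) * Fintype.card 𝒜) * (1 / Real.sqrt s) := by
        rw [mul_one_div, ← Real.sqrt_div (by positivity), ModIGW.regretScale]
        refine Real.sqrt_le_sqrt ?_
        rw [mul_comm, mul_div_right_comm]
        have := hrate (Nat.le_add_left 1 k) he2 he3 hs2
        gcongr
      have h6 : (0 : ℝ) ≤ if s ≤ alg.τ₁ then 1 else 0 := by split_ifs <;> norm_num
      have h7 := mul_le_mul_of_nonneg_left hscale (by positivity : 0 ≤ 11 * d)
      linarith
  have hfirst : ∑ s ∈ Finset.Icc 1 t, (if s ≤ alg.τ₁ then (1 : ℝ) else 0) ≤ alg.τ₁ := by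
    rw [← Finset.sum_filter, Finset.sum_const, nsmul_eq_mul, mul_one]
    have : (Finset.Icc 1 t).filter (· ≤ alg.τ₁) ⊆ Finset.Icc 1 alg.τ₁ := fun s hs => by
      simp only [Finset.mem_filter, Finset.mem_Icc] at hs ⊢; omega
    exact_mod_cast (Finset.card_le_card this).trans (by simp)
  have hsum : ∑ s ∈ Finset.Icc 1 t,
      policyRegret D.fst alg.best fstar (alg.actionProb z (epoch s)) ≤ alg.τ₁ +
        11 * d * (Real.sqrt (4 * (2 + Real.log 16 / κ) * alg.C₁ * (L * Λ) * Fintype.card 𝒜) *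
          (2 * Real.sqrt t)) := by
    refine (Finset.sum_le_sum hround).trans ?_
    rw [Finset.sum_add_distrib, ← Finset.mul_sum, ← Finset.mul_sum]
    gcongr
    exact sum_inv_sqrt_le t
  have hmain : 11 * d * (Real.sqrt (4 * (2 + Real.log 16 / κ) * alg.C₁ * (L * Λ) *
      Fintype.card 𝒜) * (2 * Real.sqrt t)) =
      44 * Real.sqrt ((2 + Real.log 16 / κ) * alg.C₁) * (d * X) := by
    have h6 : 4 * (2 + Real.log 16 / κ) * alg.C₁ * (L * Λ) * Fintype.card 𝒜 =
      2 ^ 2 * ((2 + Real.log 16 / κ) * alg.C₁) * (L * Λ * Fintype.card 𝒜) := by ring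
    have h7 : Fintype.card 𝒜 * t * L * Λ = L * Λ * Fintype.card 𝒜 * t := by ring
    rw [h6, hX, h7, Real.sqrt_mul (by positivity), Real.sqrt_mul (by positivity),
      Real.sqrt_sq (by norm_num), Real.sqrt_mul (x := L * Λ * Fintype.card 𝒜) (by positivity)]
    ring
  have hazuma : Real.sqrt (t * Real.log (1 / (alg.δ / (16 * (t : ℝ) ^ 2))) / 2) ≤
      Real.sqrt (((Real.log 16 + 2) / κ + 1) / 2) * X := by
    rw [hX, ← Real.sqrt_mul (by positivity)]
    refine Real.sqrt_le_sqrt ?_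
    calc _ ≤ t * (((Real.log 16 + 2) / κ + 1) * (L * Λ)) / 2 := by gcongr
      _ ≤ Fintype.card 𝒜 * (t * (((Real.log 16 + 2) / κ + 1) * (L * Λ)) / 2) :=
          le_mul_of_one_le_left (by positivity) hK
      _ = _ := by ring
  -- X ≥ √κ, as K, t and log t are at least 1 and Λ ≥ κ.
  have hτX : (alg.τ₁ : ℝ) ≤ alg.τ₁ / Real.sqrt κ * X := by
    rw [div_mul_eq_mul_div, le_div_iff₀ (Real.sqrt_pos.2 h2)]
    gcongr
    refine Real.sqrt_le_sqrt ?_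
    calc κ ≤ 1 * 1 * 1 * Λ := by linarith
      _ ≤ _ := by gcongr
  have hdX : X ≤ d * X := le_mul_of_one_le_left hX0 hd1
  have hdecomp : ∑ s ∈ Finset.Icc 1 t, gap alg.best fstar (z s).1 (z s).2.1 =
      regretDeviation alg D fstar epoch z t + ∑ s ∈ Finset.Icc 1 t,
        policyRegret D.fst alg.best fstar (alg.actionProb z (epoch s)) := by
    rw [regretDeviation, Finset.sum_sub_distrib, sub_add_cancel]
  have h8 : Real.sqrt (((Real.log 16 + 2) / κ + 1) / 2) * X ≤
      Real.sqrt (((Real.log 16 + 2) / κ + 1) / 2) * (d * X) := by gcongr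
  have h9 : alg.τ₁ / Real.sqrt κ * X ≤ alg.τ₁ / Real.sqrt κ * (d * X) := by gcongr
  rw [hdecomp, regretConst, add_mul, add_mul]
  linarith

end Bound

end ContextualBandit

end

/-! ### The union bound over epochs and rounds -/

theorem corollary4 :
    -- the constant hidden in `O` is a function of `C₁` and `τ₁` only
    ∃ C : ℝ → ℕ → ℝ,
      ∀ (𝒳 : Type*) [MeasurableSpace 𝒳]
        (𝒜 : Type*) [Fintype 𝒜] [Nonempty 𝒜] [DecidableEq 𝒜] [MeasurableSpace 𝒜]
        [MeasurableSingletonClass 𝒜]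
        -- environment
        (D : Measure (𝒳 × (𝒜 → unitInterval))) [IsProbabilityMeasure D]
        (fstar : Model 𝒳 𝒜) (_ : IsMeanReward D fstar)
        (πstar : 𝒳 → 𝒜) (_ : ∀ x a, fstar x a ≤ fstar x (πstar x))
        -- the model classes, and the inputs of the algorithm
        (M : ℕ) [NeZero M]
        (F : Fin M → Set (Model 𝒳 𝒜)) (_ : ∀ i, (F i).Nonempty)
        (alg : ModIGW 𝒳 𝒜 M)
        (_ : 2 ≤ alg.τ₁) (_ : 0 < alg.δ) (_ : alg.δ < 1) (_ : 0 < alg.C₁)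
        (_ : ∀ i, vcSubgraphDim (F i) = alg.d i) (_ : Monotone alg.d) (_ : ∀ i, 1 ≤ alg.d i)
        -- realizability: some class has zero misspecification, and `iStar` is the first of them
        (iStar : Fin M) (_ : IsLeast {i | maxMisspec D fstar (F i) = 0} iStar)
        -- estimation oracle
        (C₀ : ℝ) (_ : 1 ≤ C₀) (_ : EstimationGuarantee alg D fstar F C₀)
        -- a run of the algorithm, with its misspecification test
        (Ω : Type*) [MeasurableSpace Ω] (P : Measure Ω) [IsProbabilityMeasure P]
        (x : ℕ → Ω → 𝒳) (r : ℕ → Ω → 𝒜 → unitInterval) (a : ℕ → Ω → 𝒜)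
        (_ : IsRun alg D P x r a)
        (_ : TestGuarantee alg D fstar F C₀ P (observations x r a)),
        ENNReal.ofReal (1 - alg.δ) ≤
          P {ω | ∀ t : ℕ, 3 ≤ t →
            regret fstar πstar (fun s => x s ω) (fun s => a s ω) t ≤
              C alg.C₁ alg.τ₁ * (alg.d iStar *
                Real.sqrt (Fintype.card 𝒜 * t * Real.log t *
                  Real.log (M * Real.log t / alg.δ)))} := by
  refine ⟨regretConst, ?_⟩
  intro 𝒳 _ 𝒜 _ _ _ _ _ D _ fstar _ πstar hπ M _ F hF alg hτ hδ0 hδ1 hC _ hmono hd iStar hiStar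
    C₀ hC₀ hest Ω _ P _ x r a hrun htest
  have hi : maxMisspec D fstar (F iStar) = 0 := hiStar.1
  have hd1 : (1 : ℝ) ≤ alg.d iStar := by exact_mod_cast hd iStar
  choose! epoch hepoch using fun s (hs : 1 ≤ s) => exists_epoch hτ hs
  -- Index k serves both epoch k+1 (estimation and test) and round k+1 (concentration at level
  -- δ/(16(k+1)²)), so a single sum bounds all failures.
  let bad : ℕ → Set Ω := fun k =>
    ({ω | alg.d iStar * alg.unitRate (k + 1) <
        sqDist D (alg.actionKernel (observations x r a ω) (k + 1))
          (alg.fitted (observations x r a ω) (k + 1 + 1)) fstar} ∪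
      {ω | alg.mt.test iStar _ (alg.sample (observations x r a ω) (k + 1))
        (alg.conf (k + 1)) = false}ᶜ) ∪
      {ω | Real.sqrt ((k + 1 : ℕ) * Real.log (1 / (alg.δ / (16 * ((k + 1 : ℕ) : ℝ) ^ 2))) / 2) ≤
        regretDeviation alg D fstar epoch (observations x r a ω) (k + 1)}
  refine ofReal_one_sub_le_of_union (bad := bad) hδ0.le (fun k => ?_) fun ω hω => ?_
  · have hk : (1 : ℝ) ≤ ((k + 1 : ℕ) : ℝ) := by exact_mod_cast Nat.le_add_left 1 k
    have hη : alg.δ / (16 * ((k + 1 : ℕ) : ℝ) ^ 2) ≤ 1 := by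
      rw [div_le_one (by positivity)]; nlinarith
    refine (measure_union_le _ _).trans ((add_le_add ((measure_union_le _ _).trans (add_le_add
      (hrun.measure_estimate_le hτ hδ0 hδ1 (hF iStar) hi hC₀ hest (Nat.le_add_left 1 k))
      (hrun.measure_test_le hτ hδ0 hδ1 hC hi hC₀ htest (Nat.le_add_left 1 k))))
      (hrun.measure_le_regretDeviation_le fstar hepoch (Nat.le_add_left 1 k)
        (by positivity) hη)).trans (le_of_eq ?_))
    rw [← ENNReal.ofReal_add (by positivity) (by positivity),
      ← ENNReal.ofReal_add (by positivity) (by positivity)]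
    congr 1
    field_simp
    norm_num
  · simp only [bad, Set.mem_union, Set.mem_ofPred_eq, Set.mem_compl_iff, not_or, not_not, not_lt,
      not_le] at hω
    -- No accepted test ever removes i*, so the index set is nonempty and its minimum is at most i*.
    have hmem : ∀ m, iStar ∈ alg.indexSet (observations x r a ω) m := by
      intro m
      induction m using Nat.twoStepInduction with
      | zero => exact Finset.mem_univ _
      | one => exact Finset.mem_univ _
      | more m _ ih => exact Finset.mem_filter.2 ⟨ih, (hω m).1.2⟩
    have hindex : ∀ m, (alg.d (alg.index (observations x r a ω) m) : ℝ) ≤ alg.d iStar := by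
      intro m
      have h : alg.index (observations x r a ω) m ≤ iStar := by
        rw [ModIGW.index, dif_pos ⟨iStar, hmem m⟩]
        exact Finset.min'_le _ _ (hmem m)
      exact_mod_cast hmono h
    intro t ht
    have hregret : regret fstar πstar (fun s => x s ω) (fun s => a s ω) t =
        ∑ s ∈ Finset.Icc 1 t, gap alg.best fstar (observations x r a ω s).1
          (observations x r a ω s).2.1 := by
      refine Finset.sum_congr rfl fun s _ => ?_
      -- The two maximizers may be different arms, but their values agree.
      have h : fstar (x s ω) (πstar (x s ω)) = fstar (x s ω) (alg.best.pick (fstar (x s ω))) :=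
        le_antisymm (alg.best.le_pick (fstar (x s ω)) _) (hπ _ _)
      rw [h]
      rfl
    rw [hregret]
    refine sum_gap_le (D := D) hd1 hτ hδ0 hδ1 hC hd (fun m hm => ?_) hindex hepoch ht ?_
    · obtain ⟨k, rfl⟩ := Nat.exists_eq_add_of_le' hm
      exact (hω k).1.1
    · obtain ⟨k, rfl⟩ := Nat.exists_eq_add_of_le' (show 1 ≤ t by omega)
      exact (hω k).2.le
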